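/- Let $d\ge 2$ be an integer, $1<p<d$, $p^\star=\frac{pd}{d-p}$ and $\eta>0$. There is a constant $C>0$, depending only on $d$, $p$ and $\eta$, such that the following holds. Let $\Omega\subset\mathbb{R}^d$ be a bounded connected open set that is polyhedral (its boundary is a finite union of subsets of hyperplanes). Let $\mathcal D=(\mathcal M,\mathcal E,\mathcal P)$ be a discretisation of $\Omega$, that is: * $\mathcal M$ is a finite family of nonempty connected open pairwise disjoint subsets of $\Omega$ with $\overline\Omega=\bigcup_{K\in\mathcal M}\overline K$; * $\mathcal E$ is a finite family of pairwise disjoint subsets of $\overline\Omega$; each $\sigma\in\mathcal E$ is a nonempty relatively open subset of a hyperplane, its $(d-1)$-dimensional measure $|\sigma|$ is positive, and $\overline\sigma\setminus\sigma$ has $(d-1)$-dimensional measure zero; for each $K\in\mathcal M$ a subset $\mathcal E_K\subset\mathcal E$ is given with $\partial K=\bigcup_{\sigma\in\mathcal E_K}\overline\sigma$; and, with $\mathcal M_\sigma=\{K\in\mathcal M:\sigma\in\mathcal E_K\}$, for each $\sigma\in\mathcal E$ either $\mathcal M_\sigma$ has exactly one element and $\sigma\subset\partial\Omega$, or $\mathcal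 M_\sigma$ has exactly two elements; * $\mathcal P=(x_K)_{K\in\mathcal M}$ is a family of points with $x_K\in K$ such that $K$ is star-shaped with respect to $x_K$ and, for every $\sigma\in\mathcal E_K$, the Euclidean distance $d_{K,\sigma}$ from $x_K$ to the hyperplane containing $\sigma$ is positive. Assume that $\eta\le d_{K,\sigma}/d_{L,\sigma}\le 1/\eta$ for all $\sigma\in\mathcal E$ with $\mathcal M_\sigma=\{K,L\}$, $K\ne L$. Then every function $u$ on $\Omega$ that is (almost everywhere) equal to a constant $u_K$ on each $K\in\mathcal M$ satisfies $$\|u\|_{L^{p^\star}(\Omega)}\le C\,\|u\|_{1,p,\mathcal M},\qquad \|u\|_{1,p,\mathcal M}^p=\sum_{K\in\mathcal M}\sum_{\sigma\in\mathcal E_K}|\sigma|\,d_{K,\sigma}\left(\frac{D_\sigma u}{d_\sigma}\right)^p,$$ where $D_\sigma u=|u_K-u_L|$ and $d_\sigma=d_{K,\sigma}+d_{L,\sigma}$ if $\mathcal M_\sigma=\{K,L\}$ with $K\neq L$, and $D_\sigma u=|u_K|$ and $d_\sigma=d_{K,\sigma}$ if $\mathcal M_\sigma=\{K\}$. -/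

import Mathlib

open MeasureTheory
open scoped ENNReal

/-- The hyperplanes of `ℝ^d`. -/
def IsHyperplane {d : ℕ} (H : Set (EuclideanSpace ℝ (Fin d))) : Prop :=
  ∃ (n : EuclideanSpace ℝ (Fin d)) (c : ℝ), n ≠ 0 ∧ H = {x | inner ℝ n x = c}

/-- A set is polyhedral if its boundary is a finite union of subsets of hyperplanes. -/
def HasPolyhedralBoundary {d : ℕ} (A : Set (EuclideanSpace ℝ (Fin d))) : Prop :=
  ∃ 𝓗 : Set (Set (EuclideanSpace ℝ (Fin d))),
    𝓗.Finite ∧ (∀ H ∈ 𝓗, IsHyperplane H) ∧ frontier A ⊆ ⋃₀ 𝓗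

open Classical in
/-- A discretisation `(M, E, P)` of a set `Ω` of `ℝ^d` (which is meant to be open, bounded,
connected and polyhedral). The maps `edgesOf` and `center` matter only on `cells`. -/
structure Discretisation {d : ℕ} (Ω : Set (EuclideanSpace ℝ (Fin d))) where
  /-- the finite family `M` of control volumes -/
  cells : Finset (Set (EuclideanSpace ℝ (Fin d)))
  /-- the finite family `E` of edges -/
  edges : Finset (Set (EuclideanSpace ℝ (Fin d)))
  /-- the set `E_K` of the edges of the control volume `K` -/
  edgesOf : Set (EuclideanSpace ℝ (Fin d)) → Finset (Set (EuclideanSpace ℝ (Fin d)))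
  /-- the point `x_K` of the control volume `K` -/
  center : Set (EuclideanSpace ℝ (Fin d)) → EuclideanSpace ℝ (Fin d)
  cell_isOpen : ∀ K ∈ cells, IsOpen K
  cell_isConnected : ∀ K ∈ cells, IsConnected K
  cell_subset : ∀ K ∈ cells, K ⊆ Ω
  cell_disjoint : ∀ K ∈ cells, ∀ L ∈ cells, K ≠ L → Disjoint K L
  closure_eq : closure Ω = ⋃ K ∈ cells, closure K
  edge_nonempty : ∀ σ ∈ edges, σ.Nonempty
  edge_subset : ∀ σ ∈ edges, σ ⊆ closure Ω
  edge_disjoint : ∀ σ ∈ edges, ∀ τ ∈ edges, σ ≠ τ → Disjoint σ τ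
  /-- each edge is a (relatively) open subset of a hyperplane -/
  edge_open : ∀ σ ∈ edges, ∃ H U : Set (EuclideanSpace ℝ (Fin d)),
    IsHyperplane H ∧ IsOpen U ∧ σ = U ∩ H
  /-- the `(d-1)`-dimensional measure of an edge is positive -/
  edge_measure_pos : ∀ σ ∈ edges, 0 < Measure.euclideanHausdorffMeasure (d - 1) σ
  /-- the relative boundary of an edge is `(d-1)`-negligible -/
  edge_boundary_null : ∀ σ ∈ edges,
    Measure.euclideanHausdorffMeasure (d - 1) (closure σ \ σ) = 0
  edgesOf_subset : ∀ K ∈ cells, edgesOf K ⊆ edges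
  frontier_cell : ∀ K ∈ cells, frontier K = ⋃ σ ∈ edgesOf K, closure σ
  /-- an edge belongs either to exactly one control volume, and then it lies on the boundary of
  `Ω`, or to exactly two control volumes -/
  edge_cells : ∀ σ ∈ edges,
    ((cells.filter fun K => σ ∈ edgesOf K).card = 1 ∧ σ ⊆ frontier Ω) ∨
      (cells.filter fun K => σ ∈ edgesOf K).card = 2
  center_mem : ∀ K ∈ cells, center K ∈ K
  cell_starShaped : ∀ K ∈ cells, StarConvex ℝ (center K) K
  /-- the distance from `x_K` to the hyperplane that includes `σ` is positive -/
  dist_pos : ∀ K ∈ cells, ∀ σ ∈ edgesOf K,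
    0 < Metric.infDist (center K) (affineSpan ℝ σ : Set (EuclideanSpace ℝ (Fin d)))

namespace Discretisation

variable {d : ℕ} {Ω : Set (EuclideanSpace ℝ (Fin d))}

open Classical in
/-- The set `M_σ` of the control volumes that have `σ` among their edges. -/
noncomputable def cellsOf (D : Discretisation Ω) (σ : Set (EuclideanSpace ℝ (Fin d))) :
    Finset (Set (EuclideanSpace ℝ (Fin d))) :=
  D.cells.filter fun K => σ ∈ D.edgesOf K

/-- The distance `d_{K,σ}` from `x_K` to the hyperplane that includes `σ`; this hyperplane is the
affine span of `σ`, because `σ` is a nonempty relatively open subset of it. -/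
noncomputable def cellDist (D : Discretisation Ω) (K σ : Set (EuclideanSpace ℝ (Fin d))) : ℝ :=
  Metric.infDist (D.center K) (affineSpan ℝ σ : Set (EuclideanSpace ℝ (Fin d)))

/-- `d_σ`, equal to `d_{K,σ} + d_{L,σ}` if `M_σ = {K, L}` and to `d_{K,σ}` if `M_σ = {K}`. -/
noncomputable def edgeDist (D : Discretisation Ω) (σ : Set (EuclideanSpace ℝ (Fin d))) : ℝ :=
  ∑ K ∈ D.cellsOf σ, D.cellDist K σ

open Classical in
/-- For `K ∈ M_σ`, the jump `D_σ u` of the family `(u_K)` of cell values across `σ`: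
it is `|u_K - u_L|` if `M_σ = {K, L}`, and `|u_K|` if `M_σ = {K}` (the sum is empty then). -/
noncomputable def jump (D : Discretisation Ω) (v : Set (EuclideanSpace ℝ (Fin d)) → ℝ)
    (K σ : Set (EuclideanSpace ℝ (Fin d))) : ℝ :=
  |v K - ∑ L ∈ (D.cellsOf σ).erase K, v L|

theorem jump_of_cellsOf_eq_singleton (D : Discretisation Ω)
    (v : Set (EuclideanSpace ℝ (Fin d)) → ℝ) {K σ : Set (EuclideanSpace ℝ (Fin d))}
    (h : D.cellsOf σ = {K}) : D.jump v K σ = |v K| := by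
  classical
  simp [jump, h]

open Classical in
theorem jump_of_cellsOf_eq_pair (D : Discretisation Ω)
    (v : Set (EuclideanSpace ℝ (Fin d)) → ℝ) {K L σ : Set (EuclideanSpace ℝ (Fin d))}
    (hKL : K ≠ L) (h : D.cellsOf σ = {K, L}) :
    D.jump v K σ = |v K - v L| ∧ D.jump v L σ = |v K - v L| := by
  have h1 : ({K, L} : Finset (Set (EuclideanSpace ℝ (Fin d)))).erase K = {L} :=
    Finset.erase_insert (by simpa using hKL)
  have h2 : ({K, L} : Finset (Set (EuclideanSpace ℝ (Fin d)))).erase L = {K} := by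
    rw [Finset.pair_comm]
    exact Finset.erase_insert (by simpa using hKL.symm)
  constructor
  · rw [jump, h, h1, Finset.sum_singleton]
  · rw [jump, h, h2, Finset.sum_singleton, abs_sub_comm]

/-- The discrete `W^{1,p}` norm of the piecewise constant function with cell values `(u_K)`. -/
noncomputable def discreteNorm (D : Discretisation Ω) (p : ℝ)
    (v : Set (EuclideanSpace ℝ (Fin d)) → ℝ) : ℝ :=
  (∑ K ∈ D.cells, ∑ σ ∈ D.edgesOf K,
    (Measure.euclideanHausdorffMeasure (d - 1)).real σ * D.cellDist K σ *
      (D.jump v K σ / D.edgeDist σ) ^ p) ^ (1 / p)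

/-- `u` is piecewise constant on the mesh, with the value `v K` (almost everywhere) on each control
volume `K`. -/
def HasCellValues (D : Discretisation Ω) (u : EuclideanSpace ℝ (Fin d) → ℝ)
    (v : Set (EuclideanSpace ℝ (Fin d)) → ℝ) : Prop :=
  ∀ K ∈ D.cells, ∀ᵐ x ∂(volume.restrict K), u x = v K

/-- `η ≤ d_{K,σ} / d_{L,σ} ≤ 1 / η` for all edges `σ` with `M_σ = {K, L}`. -/
def IsRegular (D : Discretisation Ω) (η : ℝ) : Prop :=
  ∀ σ ∈ D.edges, ∀ K ∈ D.cellsOf σ, ∀ L ∈ D.cellsOf σ, K ≠ L →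
    η ≤ D.cellDist K σ / D.cellDist L σ ∧ D.cellDist K σ / D.cellDist L σ ≤ 1 / η

end Discretisation

/-
Every cell `K` contains the disjoint open cones from `x_K` to its edges, so that
`∑_{σ ∈ E_K} |σ| d_{K,σ} ≤ d |K|`.

For `p = 1` the inequality is the one of Gagliardo and Nirenberg. For almost every `x` the line
through `x` in a coordinate direction avoids the ridges, that is, the relative boundaries of the
edges, and the jumps met on its way out of `Ω` bound `|u(x)|`. This bound does not depend on the
coordinate along the line, so that the Loomis-Whitney argument controls the norm of `u` in
`L^{d/(d-1)}` by `∑_σ |σ| D_σ u`.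

For general `p` this is applied to `|u|^γ` with `γ = p(d-1)/(d-p)`. Its jumps are bounded by
`γ (|u_K|^(γ-1) + |u_L|^(γ-1)) D_σ u`, regularity replaces `|σ|` by `|σ| d_{K,σ} / d_σ` up to a
constant, and Hölder's inequality with the weights `|σ| d_{K,σ}` leaves a power of
`‖u‖_{L^{p⋆}}` that is absorbed by the left-hand side.
-/

section Cones

open Set Filter Topology Module

theorem eq_of_add_smul_mem_affineSubspace {k V : Type*} [Field k] [AddCommGroup V] [Module k V]
    {S : AffineSubspace k V} {x e : V} (hx : x ∉ S) {s t : k} (hs : x + s • e ∈ S)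
    (ht : x + t • e ∈ S) : s = t := by
  by_contra hst
  have hst' : t - s ≠ 0 := sub_ne_zero.2 (Ne.symm hst)
  have h := AffineMap.lineMap_mem (-s / (t - s)) hs ht
  rw [AffineMap.lineMap_apply, vsub_eq_sub, vadd_eq_add, add_sub_add_left_eq_sub, ← sub_smul,
    smul_smul, div_mul_cancel₀ _ hst', neg_smul, neg_add_cancel_comm_assoc] at h
  exact hx h

section NormedSpace

variable {E : Type*} [NormedAddCommGroup E] [NormedSpace ℝ E] {x y z : E} {K U σ : Set E}

theorem affineSpan_inter_of_isOpen {S : AffineSubspace ℝ E} (hU : IsOpen U)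
    (h : (U ∩ (S : Set E)).Nonempty) : affineSpan ℝ (U ∩ (S : Set E)) = S := by
  refine le_antisymm (affineSpan_le.2 inter_subset_right) fun w hw => ?_
  obtain ⟨y, hyU, hyS⟩ := h
  have hnear : ∀ᶠ t : ℝ in 𝓝 0, AffineMap.lineMap y w t ∈ U :=
    AffineMap.lineMap_continuous.continuousAt.eventually_mem (hU.mem_nhds (by simpa using hyU))
  obtain ⟨t, htU, ht⟩ := ((hnear.filter_mono nhdsWithin_le_nhds).and
    (self_mem_nhdsWithin (s := Ioi (0 : ℝ)))).exists
  have hmem := AffineMap.lineMap_mem (Q := affineSpan ℝ (U ∩ (S : Set E))) t⁻¹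
    (subset_affineSpan ℝ _ ⟨hyU, hyS⟩)
    (subset_affineSpan ℝ _ ⟨htU, AffineMap.lineMap_mem t hyS hw⟩)
  rwa [AffineMap.lineMap_lineMap_right, inv_mul_cancel₀ (ne_of_gt ht),
    AffineMap.lineMap_apply_one] at hmem

/- The part of the segment from `x` to `y` outside `K` would be an interval contained in the
frontier, whereas each `S i` meets the segment at most once. -/
theorem add_smul_sub_mem_of_starConvex_of_mem_closure {ι : Type*} {I : Set ι} (hI : I.Finite)
    {S : ι → AffineSubspace ℝ E} (hS : ∀ i ∈ I, x ∉ S i) (hK : IsOpen K) (hxK : x ∈ K)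
    (hstar : StarConvex ℝ x K) (hfr : frontier K ⊆ ⋃ i ∈ I, (S i : Set E)) (hy : y ∈ closure K)
    {s : ℝ} (hs0 : 0 ≤ s) (hs1 : s < 1) : x + s • (y - x) ∈ K := by
  by_contra hs
  have hnotMem : ∀ r ∈ Icc s 1, x + r • (y - x) ∉ K := by
    intro r hr hrK
    rcases hs0.eq_or_lt with rfl | hs0
    · exact hs (by simpa using hxK)
    · have hr0 : 0 < r := hs0.trans_le hr.1
      have := hstar.add_smul_sub_mem hrK (by positivity) ((div_le_one hr0).2 hr.1)
      rw [add_sub_cancel_left, smul_smul, div_mul_cancel₀ _ hr0.ne'] at this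
      exact hs this
  have hclosure : ∀ r ∈ Icc s 1, x + r • (y - x) ∈ closure K := fun r hr =>
    map_mem_closure (f := fun y => x + r • (y - x)) (by fun_prop) hy fun w hw =>
      hstar.add_smul_sub_mem hw (hs0.trans hr.1) hr.2
  have hcover : Icc s 1 ⊆ ⋃ i ∈ I, {r : ℝ | x + r • (y - x) ∈ S i} := by
    intro r hr
    have : x + r • (y - x) ∈ frontier K := by
      rw [hK.frontier_eq]
      exact ⟨hclosure r hr, hnotMem r hr⟩
    simpa using hfr this
  refine Icc_infinite hs1 ((hI.biUnion fun i hi => ?_).subset hcover)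
  exact Set.Subsingleton.finite fun r hr r' hr' =>
    eq_of_add_smul_mem_affineSubspace (hS i hi) hr hr'

/-- The open cone with apex `x` over the set `σ`, without the apex and without `σ` itself. -/
def openCone (x : E) (σ : Set E) : Set E :=
  {z | ∃ s ∈ Ioo (0 : ℝ) 1, ∃ y ∈ σ, z = x + s • (y - x)}

theorem mem_openCone_iff {ℓ : E →L[ℝ] ℝ} (hℓ : ∀ y ∈ σ, ℓ (y - x) = 1) :
    z ∈ openCone x σ ↔ ℓ (z - x) ∈ Ioo (0 : ℝ) 1 ∧ x + (ℓ (z - x))⁻¹ • (z - x) ∈ σ := by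
  constructor
  · rintro ⟨s, hs, y, hy, rfl⟩
    have hs' : ℓ (x + s • (y - x) - x) = s := by
      rw [add_sub_cancel_left, map_smul, hℓ y hy, smul_eq_mul, mul_one]
    rw [hs', add_sub_cancel_left, smul_smul, inv_mul_cancel₀ hs.1.ne', one_smul, add_sub_cancel]
    exact ⟨hs, hy⟩
  · rintro ⟨hs, hy⟩
    refine ⟨_, hs, _, hy, ?_⟩
    rw [add_sub_cancel_left, smul_smul, mul_inv_cancel₀ hs.1.ne', one_smul, add_sub_cancel]

theorem measurableSet_openCone_of_forall_eq_one [MeasurableSpace E] [BorelSpace E]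
    [SecondCountableTopology E] {ℓ : E →L[ℝ] ℝ} (hℓ : ∀ y ∈ σ, ℓ (y - x) = 1)
    (hσ : MeasurableSet σ) : MeasurableSet (openCone x σ) := by
  have h₁ : Measurable fun z => ℓ (z - x) := by fun_prop
  have h₂ : Measurable fun z => x + (ℓ (z - x))⁻¹ • (z - x) := by fun_prop
  have : openCone x σ = (fun z => ℓ (z - x)) ⁻¹' Ioo 0 1 ∩
      (fun z => x + (ℓ (z - x))⁻¹ • (z - x)) ⁻¹' σ := ext fun _ => mem_openCone_iff hℓ
  rw [this]
  exact (h₁ measurableSet_Ioo).inter (h₂ hσ)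

theorem eventually_mem_openCone {f : E →L[ℝ] ℝ} {c : ℝ} (hx : f x ≠ c) (hU : IsOpen U)
    (hy : y ∈ U ∩ {w | f w = c}) :
    ∀ᶠ z in 𝓝 y, 0 < (f z - c) * (f x - c) → z ∈ openCone x (U ∩ {w | f w = c}) := by
  have hx' : c - f x ≠ 0 := sub_ne_zero.2 hx.symm
  set ℓ : E →L[ℝ] ℝ := (c - f x)⁻¹ • f with hℓ
  have hℓ_apply : ∀ w, ℓ (w - x) = (c - f x)⁻¹ * (f w - f x) := by simp [hℓ]
  have hℓσ : ∀ w ∈ U ∩ {w | f w = c}, ℓ (w - x) = 1 := by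
    rintro w ⟨-, rfl⟩
    rw [hℓ_apply, inv_mul_cancel₀ hx']
  have hcont : ContinuousAt (fun z => ℓ (z - x)) y := by fun_prop
  have hpos : ∀ᶠ z in 𝓝 y, 0 < ℓ (z - x) :=
    hcont.eventually_const_lt (by simp [hℓσ y hy])
  have hmemU : ∀ᶠ z in 𝓝 y, x + (ℓ (z - x))⁻¹ • (z - x) ∈ U := by
    refine ContinuousAt.eventually_mem (f := fun z => x + (ℓ (z - x))⁻¹ • (z - x)) ?_ ?_
    · exact continuousAt_const.add ((hcont.inv₀ (by simp [hℓσ y hy])).smul (by fun_prop))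
    · exact hU.mem_nhds (by simpa [hℓσ y hy] using hy.1)
  filter_upwards [hpos, hmemU] with z hz0 hzU hside
  have hz1 : 1 - ℓ (z - x) = (f z - c) * (f x - c) / (c - f x) ^ 2 := by
    rw [hℓ_apply]
    field_simp
    ring
  have hlt : 0 < 1 - ℓ (z - x) := by rw [hz1]; positivity
  refine (mem_openCone_iff hℓσ).2 ⟨⟨hz0, by linarith⟩, hzU, ?_⟩
  have hf : f (x + (ℓ (z - x))⁻¹ • (z - x)) = f x + (ℓ (z - x))⁻¹ * (f z - f x) := by simp
  have hz : f z - f x = ℓ (z - x) * (c - f x) := by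
    rw [hℓ_apply, mul_right_comm, inv_mul_cancel₀ hx', one_mul]
  rw [mem_ofPred_eq, hf, hz, inv_mul_cancel_left₀ hz0.ne', add_sub_cancel]

end NormedSpace

section Volume

variable {E : Type*} [NormedAddCommGroup E] [InnerProductSpace ℝ E] {x v : E} {σ : Set E}

theorem openCone_inter_mk' (hv : v ≠ 0) (hσ : ∀ y ∈ σ, inner ℝ v (y - x) = ‖v‖ ^ 2) {r : ℝ} :
    openCone x σ ∩ AffineSubspace.mk' (r • v +ᵥ x) (ℝ ∙ v)ᗮ =
      if r ∈ Ioo (0 : ℝ) 1 then AffineMap.homothety x r '' σ else ∅ := by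
  have hv' : ‖v‖ ^ 2 ≠ 0 := by simpa using hv
  have hmem : ∀ (s : ℝ), ∀ y ∈ σ,
      (x + s • (y - x) ∈ AffineSubspace.mk' (r • v +ᵥ x) (ℝ ∙ v)ᗮ ↔ s = r) := by
    intro s y hy
    have : x + s • (y - x) - (r • v + x) = s • (y - x) - r • v := by abel
    rw [AffineSubspace.mem_mk', Submodule.mem_orthogonal_singleton_iff_inner_right, vsub_eq_sub,
      vadd_eq_add, this, inner_sub_right, inner_smul_right, inner_smul_right, hσ y hy,
      real_inner_self_eq_norm_sq, sub_eq_zero, mul_left_inj' hv']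
  have himage : ∀ y, AffineMap.homothety x r y = x + r • (y - x) := fun y => by
    rw [AffineMap.homothety_apply, vsub_eq_sub, vadd_eq_add, add_comm]
  split_ifs with hr
  · ext z
    constructor
    · rintro ⟨⟨s, -, y, hy, rfl⟩, hz⟩
      obtain rfl := (hmem s y hy).1 hz
      exact ⟨y, hy, himage y⟩
    · rintro ⟨y, hy, rfl⟩
      rw [himage]
      exact ⟨⟨r, hr, y, hy, rfl⟩, (hmem r y hy).2 rfl⟩
  · refine eq_empty_of_forall_notMem ?_
    rintro _ ⟨⟨s, hs, y, hy, rfl⟩, hz⟩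
    exact hr ((hmem s y hy).1 hz ▸ hs)

theorem inv_norm_sq_smul_innerSL_sub_eq_one (hv : v ≠ 0)
    (hσ : ∀ y ∈ σ, inner ℝ v (y - x) = ‖v‖ ^ 2) :
    ∀ y ∈ σ, ((‖v‖ ^ 2)⁻¹ • innerSL ℝ v) (y - x) = 1 := fun y hy => by
  rw [smul_apply, innerSL_apply_apply, hσ y hy, smul_eq_mul, inv_mul_cancel₀ (by simpa using hv)]

variable [FiniteDimensional ℝ E]

theorem exists_inner_sub_eq_norm_sq (hne : σ.Nonempty) (hx : x ∉ affineSpan ℝ σ) :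
    ∃ v : E, v ≠ 0 ∧ ‖v‖ = Metric.infDist x (affineSpan ℝ σ : Set E) ∧
      ∀ y ∈ σ, inner ℝ v (y - x) = ‖v‖ ^ 2 := by
  have : Nonempty (affineSpan ℝ σ) := ((affineSpan_nonempty ℝ).2 hne).to_subtype
  set π : E := ↑(EuclideanGeometry.orthogonalProjection (affineSpan ℝ σ) x) with hπ
  have hπ_mem : π ∈ affineSpan ℝ σ := SetLike.coe_mem _
  refine ⟨π - x, fun h => hx (sub_eq_zero.1 h ▸ hπ_mem), ?_, fun y hy => ?_⟩
  · rw [← dist_eq_norm, dist_comm, EuclideanGeometry.dist_orthogonalProjection_eq_infDist]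
  · have horth := (Submodule.mem_orthogonal _ _).1
      (EuclideanGeometry.vsub_orthogonalProjection_mem_direction_orthogonal (affineSpan ℝ σ) x)
      _ (AffineSubspace.vsub_mem_direction (subset_affineSpan ℝ _ hy) hπ_mem)
    rw [vsub_eq_sub, vsub_eq_sub, ← hπ, ← neg_sub π x, inner_neg_right, neg_eq_zero,
      real_inner_comm] at horth
    rw [← sub_add_sub_cancel y π x, inner_add_right, horth, zero_add, real_inner_self_eq_norm_sq]

variable [MeasurableSpace E] [BorelSpace E]

theorem lintegral_Ioo_enorm_pow (m : ℕ) :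
    ∫⁻ r in Ioo (0 : ℝ) 1, ‖r‖ₑ ^ m = (m + 1 : ℝ≥0∞)⁻¹ := by
  have hpow : ∀ r ∈ Ioo (0 : ℝ) 1, ‖r‖ₑ ^ m = ENNReal.ofReal (r ^ m) := fun r hr => by
    rw [Real.enorm_eq_ofReal hr.1.le, ENNReal.ofReal_pow hr.1.le]
  rw [setLIntegral_congr_fun measurableSet_Ioo hpow, ← ofReal_integral_eq_lintegral_ofReal,
    ← integral_Ioc_eq_integral_Ioo, ← intervalIntegral.integral_of_le zero_le_one, integral_pow]
  · rw [one_pow, zero_pow m.succ_ne_zero, sub_zero, one_div,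
      ENNReal.ofReal_inv_of_pos (by positivity)]
    congr 1
    exact_mod_cast ENNReal.ofReal_natCast (m + 1)
  · exact ((continuous_pow m).integrableOn_Icc (a := 0) (b := 1)).mono_set Ioo_subset_Icc_self
  · exact (ae_restrict_mem measurableSet_Ioo).mono fun r hr => pow_nonneg hr.1.le m

theorem finrank_mul_volume_openCone_of_inner_eq (hv : v ≠ 0)
    (hσ : ∀ y ∈ σ, inner ℝ v (y - x) = ‖v‖ ^ 2) (hσm : MeasurableSet σ) :
    finrank ℝ E * volume (openCone x σ) = μHE[finrank ℝ E - 1] σ * ‖v‖ₑ := by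
  have hnontrivial : Nontrivial E := nontrivial_of_ne v 0 hv
  obtain ⟨m, hm⟩ : ∃ m, finrank ℝ E = m + 1 :=
    Nat.exists_eq_add_one.2 (finrank_pos (R := ℝ) (M := E))
  have hslice : ∀ r : ℝ, μHE[m] (openCone x σ ∩ AffineSubspace.mk' (r • v +ᵥ x) (ℝ ∙ v)ᗮ) =
      (Ioo 0 1).indicator (fun r : ℝ => ‖r‖ₑ ^ m * μHE[m] σ) r := by
    intro r
    rw [openCone_inter_mk' hv hσ]
    split_ifs with hr
    · rw [indicator_of_mem hr, euclideanHausdorffMeasure_homothety_image m x hr.1.ne',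
        ENNReal.smul_def, smul_eq_mul, ENNReal.coe_pow, enorm_eq_nnnorm]
    · rw [indicator_of_notMem hr, measure_empty]
  have hvol := EuclideanGeometry.euclideanHausdorffMeasure_eq_lintegral x hv
    (measurableSet_openCone_of_forall_eq_one (inv_norm_sq_smul_innerSL_sub_eq_one hv hσ) hσm)
  rw [InnerProductSpace.euclideanHausdorffMeasure_eq_volume, hm, Nat.add_sub_cancel,
    lintegral_congr hslice, lintegral_indicator measurableSet_Ioo,
    lintegral_mul_const _ (by fun_prop), lintegral_Ioo_enorm_pow] at hvol
  rw [hvol, hm, Nat.add_sub_cancel, Nat.cast_add, Nat.cast_one, mul_left_comm, ← mul_assoc (_ + 1),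
    ENNReal.mul_inv_cancel (by simp) (by finiteness), one_mul, mul_comm]

theorem measurableSet_openCone (hσm : MeasurableSet σ) (hne : σ.Nonempty)
    (hx : x ∉ affineSpan ℝ σ) : MeasurableSet (openCone x σ) := by
  obtain ⟨v, hv, -, hσ⟩ := exists_inner_sub_eq_norm_sq hne hx
  exact measurableSet_openCone_of_forall_eq_one (inv_norm_sq_smul_innerSL_sub_eq_one hv hσ) hσm

theorem finrank_mul_volume_openCone (hσm : MeasurableSet σ) (hne : σ.Nonempty)
    (hx : x ∉ affineSpan ℝ σ) :
    finrank ℝ E * volume (openCone x σ) = μHE[finrank ℝ E - 1] σ *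
      ENNReal.ofReal (Metric.infDist x (affineSpan ℝ σ : Set E)) := by
  obtain ⟨v, hv, hdist, hσ⟩ := exists_inner_sub_eq_norm_sq hne hx
  rw [finrank_mul_volume_openCone_of_inner_eq hv hσ hσm, ← hdist, ofReal_norm]

end Volume

end Cones

section Jumps

open Set Filter Topology

theorem eq_of_eventually_eq_on_Icc {α : Type*} {g : ℝ → α} {a b : ℝ} (hab : a ≤ b)
    (hg : ∀ t ∈ Icc a b, ∀ᶠ s in 𝓝 t, g s = g t) : g b = g a :=
  eq_of_germ_isConstant_on (fun t ht => ⟨g t, hg t ht⟩) isPreconnected_Icc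
    (right_mem_Icc.2 hab) (left_mem_Icc.2 hab)

theorem abs_sub_le_sum_of_jumps {ι : Type*} (S : Finset ι) {τ j : ι → ℝ} {g : ℝ → ℝ}
    (hj : ∀ i ∈ S, 0 ≤ j i) {a b : ℝ} (hab : a ≤ b) (hτa : ∀ i ∈ S, τ i ≠ a)
    (hτb : ∀ i ∈ S, τ i ≠ b)
    (hg : ∀ t ∈ Icc a b, (∀ i ∈ S, τ i ≠ t) → ∀ᶠ s in 𝓝 t, g s = g t)
    (hjump : ∀ i ∈ S, ∀ᶠ s in 𝓝[≠] τ i, ∀ᶠ s' in 𝓝[≠] τ i, |g s' - g s| ≤ j i) :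
    |g b - g a| ≤ ∑ i ∈ S, j i := by
  classical
  induction S using Finset.induction_on_max_value τ generalizing b with
  | empty => simp [eq_of_eventually_eq_on_Icc hab (by simpa using hg)]
  | insert i S hi hmax ih =>
    simp only [Finset.forall_mem_insert] at hj hτa hτb hg hjump
    rw [Finset.sum_insert hi]
    by_cases hiab : τ i ∈ Ioo a b
    · have hleft : ∀ᶠ s in 𝓝[<] τ i, s ∈ Ioo a (τ i) := Ioo_mem_nhdsLT hiab.1
      have hright : ∀ᶠ s in 𝓝[>] τ i, s ∈ Ioo (τ i) b := Ioo_mem_nhdsGT hiab.2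
      have havoid : ∀ᶠ s in 𝓝[<] τ i, ∀ k ∈ S, τ k ≠ s := by
        refine S.eventually_all.2 fun k _ => ?_
        rcases eq_or_ne (τ i) (τ k) with hik | hik
        · exact hik ▸ eventually_mem_nhdsWithin.mono fun s hs => (ne_of_lt hs).symm
        · exact (eventually_ne_nhdsWithin hik).mono fun s hs => hs.symm
      obtain ⟨s, ⟨hs, hsτ⟩, hsj⟩ :=
        ((hleft.and havoid).and (hjump.1.filter_mono (nhdsLT_le_nhdsNE _))).exists
      obtain ⟨s', hs', hsj'⟩ := (hright.and (hsj.filter_mono (nhdsGT_le_nhdsNE _))).exists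
      have has : |g s - g a| ≤ ∑ k ∈ S, j k :=
        ih hj.2 hs.1.le hτa.2 hsτ (fun t ht hk =>
          hg t ⟨ht.1, ht.2.trans (hs.2.trans hiab.2).le⟩ ⟨(ht.2.trans_lt hs.2).ne', hk⟩) hjump.2
      have hs'b : g b = g s' := eq_of_eventually_eq_on_Icc hs'.2.le fun t ht =>
        have hit : τ i < t := hs'.1.trans_le ht.1
        hg t ⟨(hiab.1.trans hit).le, ht.2⟩ ⟨hit.ne, fun k hk => ((hmax k hk).trans_lt hit).ne⟩
      rw [hs'b]
      linarith [abs_sub_le (g s') (g s) (g a)]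
    · have hi_ne : ∀ t ∈ Icc a b, τ i ≠ t := by
        rintro t ht rfl
        exact hiab ⟨ht.1.lt_of_ne hτa.1.symm, ht.2.lt_of_ne hτb.1⟩
      exact (ih hj.2 hab hτa.2 hτb.2 (fun t ht hk => hg t ht ⟨hi_ne t ht, hk⟩) hjump.2).trans
        (le_add_of_nonneg_left hj.1)

end Jumps

section Escape

open Filter Bornology

theorem eventually_add_smul_notMem_of_isBounded {E : Type*} [NormedAddCommGroup E]
    [NormedSpace ℝ E] {Ω : Set E} (hΩ : IsBounded Ω) {e : E} (he : e ≠ 0) (x : E) :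
    ∀ᶠ t : ℝ in atBot, x + t • e ∉ Ω := by
  have hescape : Tendsto (fun t : ℝ => x + t • e) atBot (cobounded E) := by
    refine tendsto_norm_atTop_iff_cobounded.1 (tendsto_atTop_mono (fun t => ?_)
      (tendsto_atTop_add_const_right _ (-‖x‖)
        (tendsto_abs_atBot_atTop.atTop_mul_const (norm_pos_iff.2 he))))
    rw [← Real.norm_eq_abs, ← norm_smul, ← sub_eq_add_neg, add_comm x]
    exact norm_sub_le_norm_add _ _
  exact hescape.eventually hΩ

end Escape

namespace Discretisation

open Set Filter Topology

variable {d : ℕ} {Ω : Set (EuclideanSpace ℝ (Fin d))} {D : Discretisation Ω}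
  {K L σ τ : Set (EuclideanSpace ℝ (Fin d))} {x y : EuclideanSpace ℝ (Fin d)}

theorem mem_cellsOf : K ∈ D.cellsOf σ ↔ K ∈ D.cells ∧ σ ∈ D.edgesOf K := by
  simp [cellsOf]

theorem cellsOf_eq_singleton_or_pair (hσ : σ ∈ D.edges) :
    (∃ K, D.cellsOf σ = {K}) ∨ ∃ K L, K ≠ L ∧ D.cellsOf σ = {K, L} := by
  classical
  rcases D.edge_cells σ hσ with ⟨h, -⟩ | h
  · exact Or.inl (Finset.card_eq_one.1 h)
  · obtain ⟨K, L, hKL, hK⟩ := Finset.card_eq_two.1 h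
    exact Or.inr ⟨K, L, hKL, hK⟩

theorem cellsOf_nonempty (hσ : σ ∈ D.edges) : (D.cellsOf σ).Nonempty := by
  rcases cellsOf_eq_singleton_or_pair hσ with ⟨K, h⟩ | ⟨K, L, -, h⟩ <;> simp [h]

theorem eq_of_mem_of_mem (hK : K ∈ D.cells) (hL : L ∈ D.cells) (hxK : x ∈ K) (hxL : x ∈ L) :
    K = L := by
  by_contra hKL
  exact Set.disjoint_left.1 (D.cell_disjoint K hK L hL hKL) hxK hxL

theorem edge_eq_of_mem_of_mem (hσ : σ ∈ D.edges) (hτ : τ ∈ D.edges) (hxσ : x ∈ σ) (hxτ : x ∈ τ) :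
    σ = τ := by
  by_contra hστ
  exact Set.disjoint_left.1 (D.edge_disjoint σ hσ τ hτ hστ) hxσ hxτ

theorem edge_subset_frontier (hK : K ∈ D.cells) (hσ : σ ∈ D.edgesOf K) : σ ⊆ frontier K := by
  rw [D.frontier_cell K hK]
  exact subset_closure.trans (subset_biUnion_of_mem (u := closure) hσ)

theorem center_notMem_affineSpan (hK : K ∈ D.cells) (hσ : σ ∈ D.edgesOf K) :
    D.center K ∉ affineSpan ℝ σ := fun h =>
  (D.dist_pos K hK σ hσ).ne' (Metric.infDist_zero_of_mem h)

theorem measurableSet_edge (hσ : σ ∈ D.edges) : MeasurableSet σ := by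
  obtain ⟨_, U, ⟨n, c, -, rfl⟩, hU, rfl⟩ := D.edge_open σ hσ
  exact hU.measurableSet.inter (measurableSet_eq_fun (by fun_prop) (by fun_prop))

theorem add_smul_sub_center_mem (hK : K ∈ D.cells) (hy : y ∈ closure K) {s : ℝ} (hs0 : 0 ≤ s)
    (hs1 : s < 1) : D.center K + s • (y - D.center K) ∈ K := by
  refine add_smul_sub_mem_of_starConvex_of_mem_closure (D.edgesOf K).finite_toSet
    (S := fun σ => affineSpan ℝ σ) (fun σ hσ => center_notMem_affineSpan hK hσ)
    (D.cell_isOpen K hK) (D.center_mem K hK) (D.cell_starShaped K hK) ?_ hy hs0 hs1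
  rw [D.frontier_cell K hK]
  exact iUnion₂_mono fun σ _ => closure_minimal (subset_affineSpan ℝ σ)
    (affineSpan ℝ σ).closed_of_finiteDimensional

theorem openCone_subset (hK : K ∈ D.cells) (hσ : σ ∈ D.edgesOf K) :
    openCone (D.center K) σ ⊆ K := by
  rintro _ ⟨s, hs, y, hy, rfl⟩
  exact add_smul_sub_center_mem hK (frontier_subset_closure (edge_subset_frontier hK hσ hy))
    hs.1.le hs.2

theorem le_of_smul_sub_center_eq (hK : K ∈ D.cells) (hx : x ∈ closure K) (hy : y ∈ frontier K)
    {s t : ℝ} (hs : 0 < s) (ht : 0 < t) (h : s • (x - D.center K) = t • (y - D.center K)) :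
    t ≤ s := by
  by_contra! hst
  have hmem := add_smul_sub_center_mem hK hx (by positivity : 0 ≤ s / t) ((div_lt_one ht).2 hst)
  rw [div_eq_inv_mul, mul_smul, h, smul_smul, inv_mul_cancel₀ ht.ne', one_smul,
    add_sub_cancel] at hmem
  rw [(D.cell_isOpen K hK).frontier_eq] at hy
  exact hy.2 hmem

theorem disjoint_openCone (hK : K ∈ D.cells) (hσ : σ ∈ D.edgesOf K) (hτ : τ ∈ D.edgesOf K)
    (h : σ ≠ τ) : Disjoint (openCone (D.center K) σ) (openCone (D.center K) τ) := by
  rw [Set.disjoint_left]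
  rintro _ ⟨s, hs, y, hy, rfl⟩ ⟨t, ht, z, hz, hyz⟩
  have hyz := add_left_cancel hyz
  have hyK := edge_subset_frontier hK hσ hy
  have hzK := edge_subset_frontier hK hτ hz
  obtain rfl : s = t :=
    le_antisymm
      (le_of_smul_sub_center_eq hK (frontier_subset_closure hzK) hyK ht.1 hs.1 hyz.symm)
      (le_of_smul_sub_center_eq hK (frontier_subset_closure hyK) hzK hs.1 ht.1 hyz)
  obtain rfl : y = z := sub_left_injective (smul_right_injective _ hs.1.ne' hyz)
  exact h (edge_eq_of_mem_of_mem (D.edgesOf_subset K hK hσ) (D.edgesOf_subset K hK hτ) hy hz)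

/-- The set of the points that lie on the relative boundary of an edge, which are the points of
the cell boundaries near which more than two cells may meet. -/
def ridges (D : Discretisation Ω) : Set (EuclideanSpace ℝ (Fin d)) :=
  ⋃ σ ∈ D.edges, closure σ \ σ

theorem exists_mem_edge (hK : K ∈ D.cells) (hy : y ∈ frontier K) (hyr : y ∉ D.ridges) :
    ∃ σ ∈ D.edgesOf K, y ∈ σ := by
  rw [D.frontier_cell K hK] at hy
  obtain ⟨σ, hσ, hyσ⟩ := mem_iUnion₂.1 hy
  refine ⟨σ, hσ, ?_⟩
  by_contra h
  exact hyr (mem_iUnion₂.2 ⟨σ, D.edgesOf_subset K hK hσ, hyσ, h⟩)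

theorem mem_cellsOf_of_mem_closure (hσ : σ ∈ D.edges) (hy : y ∈ σ) (hyr : y ∉ D.ridges)
    (hL : L ∈ D.cells) (hyL : y ∈ closure L) : L ∈ D.cellsOf σ := by
  by_cases hmem : y ∈ L
  · obtain ⟨K, hKσ⟩ := cellsOf_nonempty hσ
    obtain ⟨hK, hσK⟩ := mem_cellsOf.1 hKσ
    obtain ⟨z, hzL, hzK⟩ := mem_closure_iff.1
      (frontier_subset_closure (edge_subset_frontier hK hσK hy)) L (D.cell_isOpen L hL) hmem
    exact eq_of_mem_of_mem hK hL hzK hzL ▸ hKσ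
  · have hyfr : y ∈ frontier L := (D.cell_isOpen L hL).frontier_eq ▸ ⟨hyL, hmem⟩
    obtain ⟨τ, hτ, hyτ⟩ := exists_mem_edge hL hyfr hyr
    obtain rfl := edge_eq_of_mem_of_mem hσ (D.edgesOf_subset L hL hτ) hy hyτ
    exact mem_cellsOf.2 ⟨hL, hτ⟩

theorem eventually_forall_mem_cellsOf (hσ : σ ∈ D.edges) (hy : y ∈ σ) (hyr : y ∉ D.ridges) :
    ∀ᶠ z in 𝓝 y, ∀ L ∈ D.cells, z ∈ L → L ∈ D.cellsOf σ := by
  refine D.cells.eventually_all.2 fun L hL => ?_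
  by_cases hyL : y ∈ closure L
  · exact Eventually.of_forall fun z _ => mem_cellsOf_of_mem_closure hσ hy hyr hL hyL
  · filter_upwards [isClosed_closure.isOpen_compl.mem_nhds hyL] with z hz hzL
    exact absurd (subset_closure hzL) hz

theorem exists_functional_of_mem_edge (hσ : σ ∈ D.edges) (hy : y ∈ σ) :
    ∃ f : EuclideanSpace ℝ (Fin d) →L[ℝ] ℝ, (∀ z, z ∈ affineSpan ℝ σ ↔ f (z - y) = 0) ∧
      ∀ K ∈ D.cellsOf σ, ∀ᶠ z in 𝓝 y, 0 < f (z - y) * f (D.center K - y) → z ∈ K := by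
  obtain ⟨_, U, ⟨n, c, -, rfl⟩, hU, hσU⟩ := D.edge_open σ hσ
  obtain ⟨hyU, rfl⟩ : y ∈ U ∧ inner ℝ n y = c := by simpa [hσU] using hy
  set f := innerSL ℝ n
  have hσf : σ = U ∩ {z | f z = f y} := hσU
  have hspan : ∀ z, z ∈ affineSpan ℝ σ ↔ f (z - y) = 0 := by
    have hS : {z | f z = f y} =
        (AffineSubspace.mk' y f.ker : Set (EuclideanSpace ℝ (Fin d))) := by
      ext z
      rw [SetLike.mem_coe, AffineSubspace.mem_mk', vsub_eq_sub, LinearMap.mem_ker,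
        ContinuousLinearMap.coe_coe, map_sub, sub_eq_zero, mem_ofPred_eq]
    intro z
    rw [hσf, hS, affineSpan_inter_of_isOpen hU ⟨y, hyU, by simp⟩, ← SetLike.mem_coe, ← hS,
      mem_ofPred_eq, map_sub, sub_eq_zero]
  refine ⟨f, hspan, fun K hK => ?_⟩
  obtain ⟨hK, hσK⟩ := mem_cellsOf.1 hK
  have hcenter : f (D.center K) ≠ f y := fun h =>
    center_notMem_affineSpan hK hσK ((hspan _).2 (by rw [map_sub, h, sub_self]))
  filter_upwards [eventually_mem_openCone hcenter hU (hσf ▸ hy)] with z hz hside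
  rw [map_sub, map_sub] at hside
  exact openCone_subset hK hσK (hσf ▸ hz hside)

theorem eventually_mem_or_mem (hKL : K ≠ L) (hK : K ∈ D.cellsOf σ) (hL : L ∈ D.cellsOf σ)
    (hy : y ∈ σ) : ∀ᶠ z in 𝓝 y, z ∉ affineSpan ℝ σ → z ∈ K ∨ z ∈ L := by
  have hKc := mem_cellsOf.1 hK
  have hLc := mem_cellsOf.1 hL
  obtain ⟨f, hspan, hf⟩ := exists_functional_of_mem_edge (D.edgesOf_subset K hKc.1 hKc.2) hy
  set a := f (D.center K - y)
  set b := f (D.center L - y)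
  have ha : a ≠ 0 := fun h => center_notMem_affineSpan hKc.1 hKc.2 ((hspan _).2 h)
  have hb : b ≠ 0 := fun h => center_notMem_affineSpan hLc.1 hLc.2 ((hspan _).2 h)
  have hopposite : a * b < 0 := by
    by_contra! hab
    have htendsto : Tendsto (fun t : ℝ => y + t • (D.center K - y)) (𝓝[>] 0) (𝓝 y) := by
      have : ContinuousAt (fun t : ℝ => y + t • (D.center K - y)) 0 := by fun_prop
      simpa using this.tendsto.mono_left nhdsWithin_le_nhds
    obtain ⟨t, ⟨htK, htL⟩, ht⟩ := ((htendsto.eventually ((hf K hK).and (hf L hL))).and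
      (self_mem_nhdsWithin (s := Ioi (0 : ℝ)))).exists
    have ht : 0 < t := ht
    rw [add_sub_cancel_left, map_smul, smul_eq_mul, mul_assoc] at htK htL
    exact hKL (eq_of_mem_of_mem hKc.1 hLc.1 (htK (mul_pos ht (mul_self_pos.2 ha)))
      (htL (mul_pos ht (hab.lt_of_ne (mul_ne_zero ha hb).symm))))
  filter_upwards [hf K hK, hf L hL] with z hzK hzL hz
  rcases lt_or_gt_of_ne (mul_ne_zero (fun h => hz ((hspan z).2 h)) ha) with hza | hza
  · refine Or.inr (hzL (pos_of_mul_pos_left (b := a ^ 2) ?_ (sq_nonneg a)))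
    nlinarith [mul_pos_of_neg_of_neg hza hopposite]
  · exact Or.inl (hzK hza)

/-- The piecewise constant function with the value `w K` on the cell `K`, extended by `0` outside
the cells. -/
noncomputable def cellFunction (D : Discretisation Ω) (w : Set (EuclideanSpace ℝ (Fin d)) → ℝ)
    (x : EuclideanSpace ℝ (Fin d)) : ℝ :=
  ∑ K ∈ D.cells, K.indicator (fun _ => w K) x

variable {w : Set (EuclideanSpace ℝ (Fin d)) → ℝ}

theorem cellFunction_of_mem (hK : K ∈ D.cells) (hx : x ∈ K) : D.cellFunction w x = w K := by
  rw [cellFunction, Finset.sum_eq_single_of_mem K hK, indicator_of_mem hx]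
  exact fun L hL hLK => indicator_of_notMem (fun hxL => hLK (eq_of_mem_of_mem hL hK hxL hx)) _

theorem cellFunction_of_forall_notMem (hx : ∀ K ∈ D.cells, x ∉ K) : D.cellFunction w x = 0 :=
  Finset.sum_eq_zero fun K hK => indicator_of_notMem (hx K hK) _

theorem cellFunction_eventually_eq (hy : ∀ K ∈ D.cells, y ∉ frontier K) :
    ∀ᶠ z in 𝓝 y, D.cellFunction w z = D.cellFunction w y := by
  have hmem : ∀ᶠ z in 𝓝 y, ∀ K ∈ D.cells, (z ∈ K ↔ y ∈ K) := by
    refine D.cells.eventually_all.2 fun K hK => ?_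
    by_cases hyK : y ∈ K
    · exact ((D.cell_isOpen K hK).eventually_mem hyK).mono fun z hz => iff_of_true hz hyK
    · have hyK' : y ∉ closure K := fun h =>
        hy K hK ((D.cell_isOpen K hK).frontier_eq ▸ ⟨h, hyK⟩)
      filter_upwards [isClosed_closure.isOpen_compl.mem_nhds hyK'] with z hz
      exact iff_of_false (fun h => hz (subset_closure h)) hyK
  filter_upwards [hmem] with z hz
  classical
  exact Finset.sum_congr rfl fun K hK => by simp only [indicator_apply, hz K hK]

/-- The sum of the jumps across `σ` seen from the cells that have `σ` among their edges: this is
`D_σ` of the paper for an edge with one cell, and `2 D_σ` for an edge with two cells. -/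
noncomputable def totalJump (D : Discretisation Ω) (w : Set (EuclideanSpace ℝ (Fin d)) → ℝ)
    (σ : Set (EuclideanSpace ℝ (Fin d))) : ℝ :=
  ∑ K ∈ D.cellsOf σ, D.jump w K σ

theorem jump_nonneg : 0 ≤ D.jump w K σ := abs_nonneg _

theorem totalJump_nonneg : 0 ≤ D.totalJump w σ := Finset.sum_nonneg fun _ _ => jump_nonneg

theorem exists_cellFunction_eq_or_eq_near_edge (hσ : σ ∈ D.edges) (hy : y ∈ σ)
    (hyr : y ∉ D.ridges) (w : Set (EuclideanSpace ℝ (Fin d)) → ℝ) :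
    ∃ a b, |a - b| ≤ D.totalJump w σ ∧ ∀ᶠ z in 𝓝 y, z ∉ affineSpan ℝ σ →
      D.cellFunction w z = a ∨ D.cellFunction w z = b := by
  classical
  rcases cellsOf_eq_singleton_or_pair hσ with ⟨K, hK⟩ | ⟨K, L, hKL, hKLσ⟩
  · refine ⟨w K, 0, ?_, ?_⟩
    · rw [totalJump, hK, Finset.sum_singleton, jump_of_cellsOf_eq_singleton D w hK, sub_zero]
    · filter_upwards [eventually_forall_mem_cellsOf hσ hy hyr] with z hz _
      by_cases h : ∃ L ∈ D.cells, z ∈ L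
      · obtain ⟨L, hL, hzL⟩ := h
        obtain rfl : L = K := by simpa [hK] using hz L hL hzL
        exact Or.inl (cellFunction_of_mem hL hzL)
      · push Not at h
        exact Or.inr (cellFunction_of_forall_notMem h)
  · have hK : K ∈ D.cellsOf σ := by simp [hKLσ]
    have hL : L ∈ D.cellsOf σ := by simp [hKLσ]
    refine ⟨w K, w L, ?_, ?_⟩
    · rw [← (jump_of_cellsOf_eq_pair D w hKL hKLσ).1]
      exact Finset.single_le_sum (f := fun K => D.jump w K σ) (fun _ _ => jump_nonneg) hK
    · filter_upwards [eventually_mem_or_mem hKL hK hL hy] with z hz hzσ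
      exact (hz hzσ).imp (cellFunction_of_mem (mem_cellsOf.1 hK).1)
        (cellFunction_of_mem (mem_cellsOf.1 hL).1)

theorem eventually_abs_cellFunction_sub_le (hσ : σ ∈ D.edges) (hy : y ∈ σ) (hyr : y ∉ D.ridges) :
    ∀ᶠ z in 𝓝 y, ∀ᶠ z' in 𝓝 y, z ∉ affineSpan ℝ σ → z' ∉ affineSpan ℝ σ →
      |D.cellFunction w z' - D.cellFunction w z| ≤ D.totalJump w σ := by
  obtain ⟨a, b, hab, hev⟩ := exists_cellFunction_eq_or_eq_near_edge hσ hy hyr w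
  filter_upwards [hev] with z hz
  filter_upwards [hev] with z' hz' hzσ hz'σ
  rcases hz hzσ with h | h <;> rcases hz' hz'σ with h' | h' <;>
    simp only [h, h', sub_self, abs_zero, totalJump_nonneg, hab, abs_sub_comm b a]

open Classical in
theorem abs_cellFunction_le_sum_totalJump (hΩ : Bornology.IsBounded Ω)
    {e : EuclideanSpace ℝ (Fin d)} (he : e ≠ 0) (hx : ∀ σ ∈ D.edges, x ∉ affineSpan ℝ σ)
    (hr : ∀ t : ℝ, x + t • e ∉ D.ridges) :
    |D.cellFunction w x| ≤
      ∑ σ ∈ D.edges.filter (fun σ => ∃ t : ℝ, x + t • e ∈ σ), D.totalJump w σ := by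
  set S := D.edges.filter fun σ => ∃ t : ℝ, x + t • e ∈ σ
  have hS_edge : ∀ σ ∈ S, σ ∈ D.edges := fun σ hσ => (Finset.mem_filter.1 hσ).1
  have hcross : ∀ σ ∈ S, ∃ t : ℝ, x + t • e ∈ σ := fun σ hσ => (Finset.mem_filter.1 hσ).2
  choose! τ hτ using hcross
  have hτ_unique : ∀ σ ∈ S, ∀ t : ℝ, x + t • e ∈ affineSpan ℝ σ → τ σ = t := fun σ hσ t ht =>
    eq_of_add_smul_mem_affineSubspace (hx σ (hS_edge σ hσ)) (subset_affineSpan ℝ σ (hτ σ hσ)) ht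
  obtain ⟨a, ⟨haΩ, haτ⟩, ha0⟩ : ∃ a : ℝ, (x + a • e ∉ Ω ∧ ∀ σ ∈ S, a < τ σ) ∧ a ≤ 0 :=
    (((eventually_add_smul_notMem_of_isBounded hΩ he x).and
      (S.eventually_all.2 fun σ _ => eventually_lt_atBot (τ σ))).and
        (eventually_le_atBot 0)).exists
  have hcont : Continuous fun t : ℝ => x + t • e := by fun_prop
  have hlocal : ∀ t ∈ Icc a 0, (∀ σ ∈ S, τ σ ≠ t) →
      ∀ᶠ s in 𝓝 t, D.cellFunction w (x + s • e) = D.cellFunction w (x + t • e) := by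
    intro t _ ht
    refine hcont.continuousAt.eventually (cellFunction_eventually_eq fun K hK hfr => ?_)
    obtain ⟨σ, hσK, hmem⟩ := exists_mem_edge hK hfr (hr t)
    have hσS : σ ∈ S := Finset.mem_filter.2 ⟨D.edgesOf_subset K hK hσK, t, hmem⟩
    exact ht σ hσS (hτ_unique σ hσS t (subset_affineSpan ℝ σ hmem))
  have hjump : ∀ σ ∈ S, ∀ᶠ s in 𝓝[≠] τ σ, ∀ᶠ s' in 𝓝[≠] τ σ,
      |D.cellFunction w (x + s' • e) - D.cellFunction w (x + s • e)| ≤ D.totalJump w σ := by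
    intro σ hσ
    have htendsto : Tendsto (fun t : ℝ => x + t • e) (𝓝[≠] τ σ) (𝓝 (x + τ σ • e)) :=
      hcont.continuousAt.tendsto.mono_left nhdsWithin_le_nhds
    filter_upwards [htendsto.eventually (eventually_abs_cellFunction_sub_le (hS_edge σ hσ)
      (hτ σ hσ) (hr _)), self_mem_nhdsWithin] with s hs hsτ
    filter_upwards [htendsto.eventually hs, self_mem_nhdsWithin] with s' hs' hs'τ
    exact hs' (fun h => hsτ (hτ_unique σ hσ s h).symm) (fun h => hs'τ (hτ_unique σ hσ s' h).symm)
  have hτ0 : ∀ σ ∈ S, τ σ ≠ 0 := fun σ hσ h =>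
    hx σ (hS_edge σ hσ) (subset_affineSpan ℝ σ (by simpa [h] using hτ σ hσ))
  simpa [cellFunction_of_forall_notMem fun K hK h => haΩ (D.cell_subset K hK h)] using
    abs_sub_le_sum_of_jumps S (fun _ _ => totalJump_nonneg) ha0 (fun σ hσ => (haτ σ hσ).ne') hτ0
      hlocal hjump

end Discretisation

section CoordinateProjections

open Set

variable {m : ℕ}

theorem lintegral_mul_removeNth (i : Fin (m + 1)) {g : ℝ → ℝ≥0∞} (hg : Measurable g)
    {φ : (Fin m → ℝ) → ℝ≥0∞} (hφ : Measurable φ) :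
    ∫⁻ x : Fin (m + 1) → ℝ, g (x i) * φ (i.removeNth x) = (∫⁻ t, g t) * ∫⁻ y, φ y := by
  have h := (volume_preserving_piFinSuccAbove (fun _ : Fin (m + 1) => ℝ) i).lintegral_comp_emb
    (MeasurableEquiv.measurableEmbedding _) fun z : ℝ × (Fin m → ℝ) => g z.1 * φ z.2
  simp only [MeasurableEquiv.piFinSuccAbove_apply, Fin.insertNthEquiv_symm_apply] at h
  rw [h, Measure.volume_eq_prod, lintegral_prod_mul hg.aemeasurable hφ.aemeasurable]

/- This is the inequality behind the Gagliardo–Nirenberg–Sobolev inequality, applied to the sum over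
`i` of the products of `ψ i` with the indicator function of a slab of width `1`. -/
theorem lintegral_prod_removeNth_rpow_le (hm : 0 < m) {ψ : Fin (m + 1) → (Fin m → ℝ) → ℝ≥0∞}
    (hψ : ∀ i, Measurable (ψ i)) :
    ∫⁻ x : Fin (m + 1) → ℝ, ∏ i, ψ i (i.removeNth x) ^ (1 / (m : ℝ)) ≤
      (∑ i, ∫⁻ y, ψ i y) ^ ((m + 1 : ℝ) / m) := by
  have hm' : (0 : ℝ) < m := Nat.cast_pos.2 hm
  set χ : ℝ → ℝ≥0∞ := (Ico (0 : ℝ) 1).indicator 1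
  have hχ : Measurable χ := measurable_one.indicator measurableSet_Ico
  have hχ_one : ∫⁻ t, χ t = 1 := by
    rw [lintegral_indicator_one measurableSet_Ico, Real.volume_Ico, sub_zero, ENNReal.ofReal_one]
  have hterm : ∀ i, Measurable fun x : Fin (m + 1) → ℝ => χ (x i) * ψ i (i.removeNth x) := fun i =>
    (hχ.comp (measurable_pi_apply i)).mul
      ((hψ i).comp (measurable_pi_lambda _ fun k => measurable_pi_apply (i.succAbove k)))
  set f : (Fin (m + 1) → ℝ) → ℝ≥0∞ := fun x => ∑ i, χ (x i) * ψ i (i.removeNth x)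
  have hconj : Real.HolderConjugate (Fintype.card (Fin (m + 1))) ((m + 1 : ℝ) / m) := by
    rw [Real.holderConjugate_iff, Fintype.card_fin, Nat.cast_add, Nat.cast_one]
    refine ⟨by linarith, ?_⟩
    field_simp
    ring
  have hslice : ∀ i x, ψ i (i.removeNth x) ≤ ∫⁻ t, f (Function.update x i t) := fun i x =>
    calc ψ i (i.removeNth x) = ∫⁻ t, χ t * ψ i (i.removeNth x) := by
          rw [lintegral_mul_const _ hχ, hχ_one, one_mul]
      _ ≤ ∫⁻ t, f (Function.update x i t) := lintegral_mono fun t => by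
          simpa using Finset.single_le_sum (fun _ _ => zero_le) (Finset.mem_univ i)
            (f := fun j => χ (Function.update x i t j) * ψ j (j.removeNth (Function.update x i t)))
  have hint : ∫⁻ x, f x = ∑ i, ∫⁻ y, ψ i y := by
    rw [lintegral_finsetSum _ fun i _ => hterm i]
    simp only [lintegral_mul_removeNth _ hχ (hψ _), hχ_one, one_mul]
  have hGNS := lintegral_prod_lintegral_pow_le (fun _ => volume) hconj
    (Finset.measurable_sum _ fun i _ => hterm i : Measurable f)
  rw [← volume_pi, hint, Fintype.card_fin, Nat.cast_add, Nat.cast_one, add_sub_cancel_right]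
    at hGNS
  exact (lintegral_mono fun x => Finset.prod_le_prod' fun i _ =>
    ENNReal.rpow_le_rpow (hslice i x) (by positivity)).trans hGNS

/-- The projection of `ℝ^(m+1)` onto `ℝ^m` that forgets the coordinate `i`. -/
def dropCoord (i : Fin (m + 1)) (x : EuclideanSpace ℝ (Fin (m + 1))) : EuclideanSpace ℝ (Fin m) :=
  WithLp.toLp 2 (i.removeNth x.ofLp)

theorem lipschitzWith_dropCoord (i : Fin (m + 1)) : LipschitzWith 1 (dropCoord i) := by
  refine LipschitzWith.of_dist_le_mul fun x y => ?_
  rw [NNReal.coe_one, one_mul, EuclideanSpace.dist_eq, EuclideanSpace.dist_eq,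
    Fin.sum_univ_succAbove _ i]
  exact Real.sqrt_le_sqrt (le_add_of_nonneg_left (sq_nonneg _))

theorem dropCoord_add_smul_single (i : Fin (m + 1)) (x : EuclideanSpace ℝ (Fin (m + 1))) (t : ℝ) :
    dropCoord i (x + t • EuclideanSpace.single i 1) = dropCoord i x := by
  ext k
  simp [dropCoord, Fin.removeNth]

theorem quasiMeasurePreserving_dropCoord (i : Fin (m + 1)) :
    Measure.QuasiMeasurePreserving (dropCoord i) volume volume :=
  (PiLp.volume_preserving_toLp (Fin m)).quasiMeasurePreserving.comp
    (Measure.quasiMeasurePreserving_snd.comp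
      ((volume_preserving_piFinSuccAbove (fun _ => ℝ) i).quasiMeasurePreserving.comp
        (PiLp.volume_preserving_ofLp (Fin (m + 1))).quasiMeasurePreserving))

theorem lintegral_prod_dropCoord_rpow_le (hm : 0 < m)
    {ψ : Fin (m + 1) → EuclideanSpace ℝ (Fin m) → ℝ≥0∞} (hψ : ∀ i, Measurable (ψ i)) :
    ∫⁻ x, ∏ i, ψ i (dropCoord i x) ^ (1 / (m : ℝ)) ≤
      (∑ i, ∫⁻ y, ψ i y) ^ ((m + 1 : ℝ) / m) := by
  have hmp := PiLp.volume_preserving_toLp (Fin m)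
  have h := lintegral_prod_removeNth_rpow_le hm fun i => (hψ i).comp hmp.measurable
  have hprod : Measurable fun x => ∏ i, ψ i (dropCoord i x) ^ (1 / (m : ℝ)) :=
    Finset.measurable_prod _ fun i _ =>
      ((hψ i).comp (lipschitzWith_dropCoord i).continuous.measurable).pow_const _
  rw [← (PiLp.volume_preserving_toLp (Fin (m + 1))).lintegral_comp hprod]
  simp only [Function.comp_apply, hmp.lintegral_comp (hψ _)] at h
  exact h

theorem euclideanHausdorffMeasure_image_le_of_lipschitzWith_one {X Y : Type*} [EMetricSpace X]
    [EMetricSpace Y] [MeasurableSpace X] [BorelSpace X] [MeasurableSpace Y] [BorelSpace Y]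
    {f : X → Y} (hf : LipschitzWith 1 f) (k : ℕ) (s : Set X) : μHE[k] (f '' s) ≤ μHE[k] s := by
  have h := hf.hausdorffMeasure_image_le (d := k) (Nat.cast_nonneg k) s
  rw [ENNReal.coe_one, ENNReal.one_rpow, one_mul] at h
  simp_rw [Measure.euclideanHausdorffMeasure_def, Measure.smul_apply]
  gcongr

theorem volume_image_dropCoord_le (i : Fin (m + 1)) (s : Set (EuclideanSpace ℝ (Fin (m + 1)))) :
    volume (dropCoord i '' s) ≤ μHE[m] s := by
  rw [← EuclideanSpace.euclideanHausdorffMeasure_eq_volume]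
  exact euclideanHausdorffMeasure_image_le_of_lipschitzWith_one (lipschitzWith_dropCoord i) m s

end CoordinateProjections

namespace Discretisation

open Set Filter Topology

section

variable {d : ℕ} {Ω : Set (EuclideanSpace ℝ (Fin d))} {D : Discretisation Ω}
  {w : Set (EuclideanSpace ℝ (Fin d)) → ℝ} {K σ : Set (EuclideanSpace ℝ (Fin d))}

theorem ae_forall_notMem_affineSpan (D : Discretisation Ω) :
    ∀ᵐ x, ∀ σ ∈ D.edges, x ∉ affineSpan ℝ σ := by
  refine (D.edges.eventually_all).2 fun σ hσ => ?_
  obtain ⟨K, hKσ⟩ := cellsOf_nonempty hσ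
  obtain ⟨hK, hσK⟩ := mem_cellsOf.1 hKσ
  exact measure_eq_zero_iff_ae_notMem.1 (Measure.addHaar_affineSubspace _ _ fun htop =>
    center_notMem_affineSpan hK hσK (htop ▸ AffineSubspace.mem_top ℝ _ _))

theorem measure_ridges (D : Discretisation Ω) : μHE[d - 1] D.ridges = 0 :=
  (measure_biUnion_null_iff D.edges.countable_toSet).2 D.edge_boundary_null

theorem volume_cell_ne_top (hΩ : Bornology.IsBounded Ω) (hK : K ∈ D.cells) : volume K ≠ ∞ :=
  (hΩ.subset (D.cell_subset K hK)).measure_lt_top.ne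

theorem sum_measure_mul_cellDist_le (hK : K ∈ D.cells) :
    ∑ σ ∈ D.edgesOf K, μHE[d - 1] σ * ENNReal.ofReal (D.cellDist K σ) ≤ d * volume K := by
  have hedge : ∀ σ ∈ D.edgesOf K, MeasurableSet σ ∧ σ.Nonempty ∧ D.center K ∉ affineSpan ℝ σ :=
    fun σ hσ => ⟨measurableSet_edge (D.edgesOf_subset K hK hσ),
      D.edge_nonempty σ (D.edgesOf_subset K hK hσ), center_notMem_affineSpan hK hσ⟩
  calc ∑ σ ∈ D.edgesOf K, μHE[d - 1] σ * ENNReal.ofReal (D.cellDist K σ)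
      = ∑ σ ∈ D.edgesOf K, d * volume (openCone (D.center K) σ) := by
        refine Finset.sum_congr rfl fun σ hσ => ?_
        obtain ⟨hσm, hne, hcenter⟩ := hedge σ hσ
        simpa [cellDist] using (finrank_mul_volume_openCone hσm hne hcenter).symm
    _ = d * volume (⋃ σ ∈ D.edgesOf K, openCone (D.center K) σ) := by
        rw [← Finset.mul_sum, measure_biUnion_finset]
        · exact fun σ hσ τ hτ h => disjoint_openCone hK hσ hτ h
        · intro σ hσ
          obtain ⟨hσm, hne, hcenter⟩ := hedge σ hσ
          exact measurableSet_openCone hσm hne hcenter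
    _ ≤ d * volume K := by
        gcongr
        exact iUnion₂_subset fun σ hσ => openCone_subset hK hσ

theorem measure_edge_ne_top (hΩ : Bornology.IsBounded Ω) (hσ : σ ∈ D.edges) :
    μHE[d - 1] σ ≠ ∞ := by
  obtain ⟨K, hKσ⟩ := cellsOf_nonempty hσ
  obtain ⟨hK, hσK⟩ := mem_cellsOf.1 hKσ
  have hle : μHE[d - 1] σ * ENNReal.ofReal (D.cellDist K σ) ≤ d * volume K :=
    (Finset.single_le_sum (f := fun σ => μHE[d - 1] σ * ENNReal.ofReal (D.cellDist K σ))
      (fun _ _ => zero_le) hσK).trans (sum_measure_mul_cellDist_le hK)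
  intro htop
  have hdist : ENNReal.ofReal (D.cellDist K σ) ≠ 0 :=
    (ENNReal.ofReal_pos.2 (D.dist_pos K hK σ hσK)).ne'
  rw [htop, ENNReal.top_mul hdist, top_le_iff] at hle
  exact ENNReal.mul_ne_top (by simp) (volume_cell_ne_top hΩ hK) hle

/-- The discrete total variation of the cell values `(w_K)`, in which the jump across an edge that
separates two cells is counted twice. -/
noncomputable def variation (D : Discretisation Ω) (w : Set (EuclideanSpace ℝ (Fin d)) → ℝ) : ℝ :=
  ∑ σ ∈ D.edges, μHE[d - 1].real σ * D.totalJump w σ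

theorem variation_nonneg : 0 ≤ D.variation w :=
  Finset.sum_nonneg fun _ _ => mul_nonneg measureReal_nonneg totalJump_nonneg

/-- The integral of `|u|^q` for the piecewise constant function `u` with the cell values
`(w_K)`. -/
noncomputable def powerSum (D : Discretisation Ω) (q : ℝ)
    (w : Set (EuclideanSpace ℝ (Fin d)) → ℝ) : ℝ :=
  ∑ K ∈ D.cells, volume.real K * |w K| ^ q

theorem powerSum_nonneg {q : ℝ} : 0 ≤ D.powerSum q w :=
  Finset.sum_nonneg fun K _ => by positivity

theorem lintegral_cellFunction_rpow {q : ℝ} (hq : 0 < q) (hΩ : Bornology.IsBounded Ω) :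
    ∫⁻ x, ‖D.cellFunction w x‖ₑ ^ q = ENNReal.ofReal (D.powerSum q w) := by
  have h : ∀ x, ‖D.cellFunction w x‖ₑ ^ q =
      ∑ K ∈ D.cells, K.indicator (fun _ => ‖w K‖ₑ ^ q) x := by
    intro x
    by_cases hx : ∃ K ∈ D.cells, x ∈ K
    · obtain ⟨K, hK, hxK⟩ := hx
      rw [cellFunction_of_mem hK hxK, Finset.sum_eq_single_of_mem K hK, indicator_of_mem hxK]
      exact fun L hL hLK => indicator_of_notMem (fun hxL => hLK (eq_of_mem_of_mem hL hK hxL hxK)) _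
    · push Not at hx
      rw [cellFunction_of_forall_notMem hx, enorm_zero, ENNReal.zero_rpow_of_pos hq]
      exact (Finset.sum_eq_zero fun K hK => indicator_of_notMem (hx K hK) _).symm
  simp_rw [h]
  rw [powerSum, ENNReal.ofReal_sum_of_nonneg fun K _ => by positivity,
    lintegral_finsetSum _ fun K hK =>
      measurable_const.indicator (D.cell_isOpen K hK).measurableSet]
  refine Finset.sum_congr rfl fun K hK => ?_
  rw [lintegral_indicator_const (D.cell_isOpen K hK).measurableSet,
    ENNReal.ofReal_mul measureReal_nonneg, ofReal_measureReal (volume_cell_ne_top hΩ hK),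
    ← ofReal_norm, Real.norm_eq_abs, ENNReal.ofReal_rpow_of_nonneg (abs_nonneg _) hq.le, mul_comm]

end

section

variable {m : ℕ} {Ω : Set (EuclideanSpace ℝ (Fin (m + 1)))} {D : Discretisation Ω}
  {w : Set (EuclideanSpace ℝ (Fin (m + 1))) → ℝ}

theorem ae_forall_add_smul_single_notMem_ridges (D : Discretisation Ω) (i : Fin (m + 1)) :
    ∀ᵐ x, ∀ t : ℝ, x + t • EuclideanSpace.single i 1 ∉ D.ridges := by
  have hnull : volume (dropCoord i '' D.ridges) = 0 :=
    le_antisymm ((volume_image_dropCoord_le i _).trans_eq D.measure_ridges) zero_le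
  filter_upwards [(quasiMeasurePreserving_dropCoord i).ae (measure_eq_zero_iff_ae_notMem.1 hnull)]
    with x hx t ht
  exact hx ⟨_, ht, dropCoord_add_smul_single i x t⟩

/-- An upper bound for the sum of the jumps met by the line in the direction `i` above a point of
the hyperplane of the other coordinates. Measurable hulls are taken because the projections of the
edges need not be Borel sets. -/
noncomputable def jumpProfile (D : Discretisation Ω)
    (w : Set (EuclideanSpace ℝ (Fin (m + 1))) → ℝ) (i : Fin (m + 1))
    (y : EuclideanSpace ℝ (Fin m)) : ℝ≥0∞ :=
  ∑ σ ∈ D.edges, ENNReal.ofReal (D.totalJump w σ) *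
    (toMeasurable volume (dropCoord i '' σ)).indicator 1 y

theorem measurable_indicator_toMeasurable_dropCoord (i : Fin (m + 1))
    (σ : Set (EuclideanSpace ℝ (Fin (m + 1)))) :
    Measurable ((toMeasurable volume (dropCoord i '' σ)).indicator
      (1 : EuclideanSpace ℝ (Fin m) → ℝ≥0∞)) :=
  measurable_one.indicator (measurableSet_toMeasurable _ _)

theorem measurable_jumpProfile (i : Fin (m + 1)) : Measurable (D.jumpProfile w i) :=
  Finset.measurable_sum _ fun σ _ =>
    (measurable_indicator_toMeasurable_dropCoord i σ).const_mul _

theorem lintegral_jumpProfile_le (hΩ : Bornology.IsBounded Ω) (i : Fin (m + 1)) :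
    ∫⁻ y, D.jumpProfile w i y ≤ ENNReal.ofReal (D.variation w) := by
  have hind := measurable_indicator_toMeasurable_dropCoord i
  simp only [jumpProfile]
  rw [lintegral_finsetSum _ fun σ _ => (hind σ).const_mul _, variation,
    ENNReal.ofReal_sum_of_nonneg fun _ _ => mul_nonneg measureReal_nonneg totalJump_nonneg]
  refine Finset.sum_le_sum fun σ hσ => ?_
  rw [lintegral_const_mul _ (hind σ), lintegral_indicator_one (measurableSet_toMeasurable _ _),
    measure_toMeasurable, ENNReal.ofReal_mul measureReal_nonneg,
    ofReal_measureReal (measure_edge_ne_top hΩ hσ), mul_comm]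
  gcongr
  exact volume_image_dropCoord_le i σ

theorem ae_enorm_cellFunction_le_jumpProfile (hΩ : Bornology.IsBounded Ω) :
    ∀ᵐ x, ∀ i, ‖D.cellFunction w x‖ₑ ≤ D.jumpProfile w i (dropCoord i x) := by
  classical
  filter_upwards [D.ae_forall_notMem_affineSpan,
    ae_all_iff.2 D.ae_forall_add_smul_single_notMem_ridges] with x hx hr i
  have h := abs_cellFunction_le_sum_totalJump (w := w) hΩ (e := EuclideanSpace.single i 1)
    (by simp) hx (hr i)
  rw [← ofReal_norm, Real.norm_eq_abs]
  refine (ENNReal.ofReal_le_ofReal h).trans ?_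
  rw [ENNReal.ofReal_sum_of_nonneg fun _ _ => totalJump_nonneg, Finset.sum_filter]
  refine Finset.sum_le_sum fun σ _ => ?_
  split_ifs with hσ
  · obtain ⟨t, ht⟩ := hσ
    rw [indicator_of_mem, Pi.one_apply, mul_one]
    exact subset_toMeasurable _ _ ⟨_, ht, dropCoord_add_smul_single i x t⟩
  · exact zero_le

theorem lintegral_cellFunction_rpow_le_variation (hm : 0 < m) (hΩ : Bornology.IsBounded Ω) :
    ∫⁻ x, ‖D.cellFunction w x‖ₑ ^ ((m + 1 : ℝ) / m) ≤
      ENNReal.ofReal ((m + 1) * D.variation w) ^ ((m + 1 : ℝ) / m) := by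
  calc ∫⁻ x, ‖D.cellFunction w x‖ₑ ^ ((m + 1 : ℝ) / m)
      = ∫⁻ x, ∏ _i : Fin (m + 1), ‖D.cellFunction w x‖ₑ ^ (1 / (m : ℝ)) := by
        simp_rw [Finset.prod_const, Finset.card_univ, Fintype.card_fin, ← ENNReal.rpow_natCast,
          ← ENNReal.rpow_mul, Nat.cast_add, Nat.cast_one, one_div_mul_eq_div]
    _ ≤ ∫⁻ x, ∏ i, D.jumpProfile w i (dropCoord i x) ^ (1 / (m : ℝ)) := by
        refine lintegral_mono_ae ?_
        filter_upwards [ae_enorm_cellFunction_le_jumpProfile hΩ] with x hx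
        exact Finset.prod_le_prod' fun i _ => ENNReal.rpow_le_rpow (hx i) (by positivity)
    _ ≤ (∑ i, ∫⁻ y, D.jumpProfile w i y) ^ ((m + 1 : ℝ) / m) :=
        lintegral_prod_dropCoord_rpow_le hm measurable_jumpProfile
    _ ≤ (∑ _i : Fin (m + 1), ENNReal.ofReal (D.variation w)) ^ ((m + 1 : ℝ) / m) := by
        gcongr
        exact lintegral_jumpProfile_le hΩ _
    _ = ENNReal.ofReal ((m + 1) * D.variation w) ^ ((m + 1 : ℝ) / m) := by
        rw [Finset.sum_const, Finset.card_univ, Fintype.card_fin, nsmul_eq_mul,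
          ENNReal.ofReal_mul (by positivity)]
        norm_cast

end

theorem powerSum_rpow_le_variation {d : ℕ} (hd : 1 < d) {Ω : Set (EuclideanSpace ℝ (Fin d))}
    (D : Discretisation Ω) (hΩ : Bornology.IsBounded Ω)
    (w : Set (EuclideanSpace ℝ (Fin d)) → ℝ) :
    D.powerSum (d / (d - 1)) w ^ ((d - 1) / d : ℝ) ≤ d * D.variation w := by
  obtain ⟨m, rfl⟩ : ∃ m, d = m + 1 := ⟨d - 1, by lia⟩
  have hm : 0 < m := by lia
  have : (0 : ℝ) < m := Nat.cast_pos.2 hm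
  have hV := variation_nonneg (D := D) (w := w)
  have h := lintegral_cellFunction_rpow_le_variation (D := D) (w := w) hm hΩ
  rw [lintegral_cellFunction_rpow (by positivity) hΩ,
    ENNReal.ofReal_rpow_of_nonneg (by positivity) (by positivity),
    ENNReal.ofReal_le_ofReal_iff (by positivity)] at h
  rw [Nat.cast_add, Nat.cast_one, add_sub_cancel_right, ← inv_div (m + 1 : ℝ) m]
  exact (Real.rpow_inv_le_iff_of_pos powerSum_nonneg (by positivity) (by positivity)).2 h

end Discretisation

theorem abs_rpow_sub_rpow_le {a b γ : ℝ} (ha : 0 ≤ a) (hb : 0 ≤ b) (hγ : 1 ≤ γ) :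
    |a ^ γ - b ^ γ| ≤ γ * (a ^ (γ - 1) + b ^ (γ - 1)) * |a - b| := by
  wlog hab : b ≤ a generalizing a b
  · have := this hb ha (le_of_not_ge hab)
    rwa [abs_sub_comm, abs_sub_comm b a, add_comm (b ^ (γ - 1))] at this
  rw [abs_of_nonneg (sub_nonneg.2 (Real.rpow_le_rpow hb hab (by linarith))),
    abs_of_nonneg (sub_nonneg.2 hab)]
  rcases ha.eq_or_lt with rfl | ha0
  · simp [le_antisymm hab hb]
  have hbernoulli : 1 + γ * (b / a - 1) ≤ (b / a) ^ γ := by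
    have := one_add_mul_self_le_rpow_one_add (s := b / a - 1)
      (by linarith [div_nonneg hb ha]) hγ
    rwa [add_sub_cancel] at this
  have hpow : a ^ γ = a ^ (γ - 1) * a := by
    rw [← Real.rpow_add_one ha0.ne', sub_add_cancel]
  have htangent : a ^ γ - b ^ γ ≤ γ * a ^ (γ - 1) * (a - b) := by
    rw [Real.div_rpow hb ha, le_div_iff₀ (by positivity)] at hbernoulli
    have hexpand : (1 + γ * (b / a - 1)) * a ^ γ = a ^ γ - γ * a ^ (γ - 1) * (a - b) := by
      rw [hpow]
      field_simp
      ring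
    linarith
  have hnonneg : 0 ≤ γ * b ^ (γ - 1) * (a - b) := mul_nonneg (by positivity) (sub_nonneg.2 hab)
  linarith

theorem sum_rpow_mul_rpow_le {ι : Type*} (s : Finset ι) {f g : ι → ℝ} (hf : ∀ i, 0 ≤ f i)
    (hg : ∀ i, 0 ≤ g i) {a b : ℝ} (ha : 0 ≤ a) (hb : 0 ≤ b) (hab : a + b = 1) :
    ∑ i ∈ s, f i ^ a * g i ^ b ≤ (∑ i ∈ s, f i) ^ a * (∑ i ∈ s, g i) ^ b := by
  rcases ha.eq_or_lt with rfl | ha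
  · obtain rfl : b = 1 := by linarith
    simp
  rcases hb.eq_or_lt with rfl | hb
  · obtain rfl : a = 1 := by linarith
    simp
  have h := Real.inner_le_Lp_mul_Lq_of_nonneg s (Real.HolderConjugate.inv_inv ha hb hab)
    (fun i _ => Real.rpow_nonneg (hf i) a) (fun i _ => Real.rpow_nonneg (hg i) b)
  simpa only [Real.rpow_rpow_inv (hf _) ha.ne', Real.rpow_rpow_inv (hg _) hb.ne', one_div,
    inv_inv] using h

namespace Discretisation

open Set

variable {d : ℕ} {Ω : Set (EuclideanSpace ℝ (Fin d))} {D : Discretisation Ω}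
  {v : Set (EuclideanSpace ℝ (Fin d)) → ℝ} {K σ : Set (EuclideanSpace ℝ (Fin d))} {p q γ η : ℝ}

theorem ae_eq_cellFunction {u : EuclideanSpace ℝ (Fin d) → ℝ} (hu : D.HasCellValues u v) :
    u =ᵐ[volume.restrict (closure Ω)] D.cellFunction v := by
  have hcells : ∀ᵐ x, ∀ K ∈ D.cells, x ∈ K → u x = v K := by
    rw [Finset.eventually_all]
    exact fun K hK => (ae_restrict_iff' (D.cell_isOpen K hK).measurableSet).1 (hu K hK)
  filter_upwards [ae_restrict_of_ae hcells, ae_restrict_of_ae D.ae_forall_notMem_affineSpan,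
    ae_restrict_mem isClosed_closure.measurableSet] with x hx hxσ hxΩ
  rw [D.closure_eq] at hxΩ
  obtain ⟨K, hK, hxK⟩ := mem_iUnion₂.1 hxΩ
  have hmem : x ∈ K := by
    by_contra hnot
    have hfrontier : x ∈ frontier K := ⟨hxK, fun h => hnot (interior_subset h)⟩
    rw [D.frontier_cell K hK] at hfrontier
    obtain ⟨σ, hσ, hxσ'⟩ := mem_iUnion₂.1 hfrontier
    exact hxσ σ (D.edgesOf_subset K hK hσ) (closure_minimal (subset_affineSpan ℝ σ)
      (affineSpan ℝ σ).closed_of_finiteDimensional hxσ')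
  rw [hx K hK hmem, cellFunction_of_mem hK hmem]

theorem totalJump_abs_rpow_le (hγ : 1 ≤ γ) (hσ : σ ∈ D.edges) :
    D.totalJump (fun K => |v K| ^ γ) σ ≤
      2 * γ * ∑ K ∈ D.cellsOf σ, |v K| ^ (γ - 1) * D.jump v K σ := by
  rw [totalJump]
  rcases cellsOf_eq_singleton_or_pair hσ with ⟨K, h⟩ | ⟨K, L, hKL, h⟩
  · rw [h, Finset.sum_singleton, Finset.sum_singleton, jump_of_cellsOf_eq_singleton D _ h,
      jump_of_cellsOf_eq_singleton D _ h, abs_of_nonneg (by positivity),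
      ← Real.rpow_add_one' (abs_nonneg _) (by linarith), sub_add_cancel]
    exact le_mul_of_one_le_left (by positivity) (by linarith)
  · classical
    obtain ⟨hK, hL⟩ := jump_of_cellsOf_eq_pair D v hKL h
    obtain ⟨hKγ, hLγ⟩ := jump_of_cellsOf_eq_pair D (fun K => |v K| ^ γ) hKL h
    rw [h, Finset.sum_pair hKL, Finset.sum_pair hKL, hK, hL, hKγ, hLγ]
    have hdiff : |(|v K| ^ γ - |v L| ^ γ)| ≤
        γ * (|v K| ^ (γ - 1) + |v L| ^ (γ - 1)) * |v K - v L| :=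
      (abs_rpow_sub_rpow_le (abs_nonneg _) (abs_nonneg _) hγ).trans
        (mul_le_mul_of_nonneg_left (abs_abs_sub_abs_le_abs_sub _ _) (by positivity))
    linarith

theorem sum_edges_sum_cellsOf (f : Set (EuclideanSpace ℝ (Fin d)) →
    Set (EuclideanSpace ℝ (Fin d)) → ℝ) :
    ∑ σ ∈ D.edges, ∑ K ∈ D.cellsOf σ, f K σ = ∑ K ∈ D.cells, ∑ σ ∈ D.edgesOf K, f K σ := by
  refine Finset.sum_comm' fun σ K => ?_
  rw [mem_cellsOf]
  exact ⟨fun h => ⟨h.2.2, h.2.1⟩, fun h => ⟨D.edgesOf_subset K h.2 h.1, h.2, h.1⟩⟩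

theorem variation_abs_rpow_le (hγ : 1 ≤ γ) :
    D.variation (fun K => |v K| ^ γ) ≤ 2 * γ * ∑ K ∈ D.cells, ∑ σ ∈ D.edgesOf K,
      μHE[d - 1].real σ * (|v K| ^ (γ - 1) * D.jump v K σ) := by
  rw [variation, ← sum_edges_sum_cellsOf, Finset.mul_sum]
  refine Finset.sum_le_sum fun σ hσ => ?_
  rw [← Finset.mul_sum, mul_left_comm]
  gcongr
  exact totalJump_abs_rpow_le hγ hσ

theorem powerSum_abs_rpow : D.powerSum q (fun K => |v K| ^ γ) = D.powerSum (γ * q) v := by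
  refine Finset.sum_congr rfl fun K _ => ?_
  rw [abs_of_nonneg (by positivity), ← Real.rpow_mul (abs_nonneg _)]

theorem cellDist_nonneg : 0 ≤ D.cellDist K σ := Metric.infDist_nonneg

theorem cellDist_pos (hKσ : K ∈ D.cellsOf σ) : 0 < D.cellDist K σ :=
  have h := mem_cellsOf.1 hKσ
  D.dist_pos K h.1 σ h.2

theorem edgeDist_nonneg : 0 ≤ D.edgeDist σ := Finset.sum_nonneg fun _ _ => cellDist_nonneg

theorem edgeDist_pos (hKσ : K ∈ D.cellsOf σ) : 0 < D.edgeDist σ :=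
  Finset.sum_pos (fun _ hL => cellDist_pos hL) ⟨K, hKσ⟩

theorem IsRegular.edgeDist_le (hη : 0 < η) (hD : D.IsRegular η) (hKσ : K ∈ D.cellsOf σ) :
    D.edgeDist σ ≤ (1 + 1 / η) * D.cellDist K σ := by
  obtain ⟨hK, hσK⟩ := mem_cellsOf.1 hKσ
  have hσ := D.edgesOf_subset K hK hσK
  have hneighbour : ∀ L ∈ D.cellsOf σ, K ≠ L → D.cellDist L σ ≤ 1 / η * D.cellDist K σ :=
    fun L hL hKL => (div_le_iff₀ (cellDist_pos hKσ)).1 (hD σ hσ L hL K hKσ hKL.symm).2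
  rw [add_mul, one_mul]
  rcases cellsOf_eq_singleton_or_pair hσ with ⟨K', h⟩ | ⟨K', L, hKL, h⟩
  · obtain rfl : K = K' := by simpa [h] using hKσ
    rw [edgeDist, h, Finset.sum_singleton]
    exact le_add_of_nonneg_right (mul_nonneg (by positivity) cellDist_nonneg)
  · rw [edgeDist, h, Finset.sum_pair hKL]
    obtain rfl | rfl : K = K' ∨ K = L := by simpa [h] using hKσ
    · exact add_le_add le_rfl (hneighbour L (by simp [h]) hKL)
    · rw [add_comm]
      exact add_le_add le_rfl (hneighbour K' (by simp [h]) hKL.symm)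

/-- `|σ| d_{K,σ}`, which is `d` times the volume of the cone with apex `x_K` and base `σ`. -/
noncomputable def coneMass (D : Discretisation Ω) (K σ : Set (EuclideanSpace ℝ (Fin d))) : ℝ :=
  μHE[d - 1].real σ * D.cellDist K σ

theorem coneMass_nonneg : 0 ≤ D.coneMass K σ := mul_nonneg measureReal_nonneg cellDist_nonneg

theorem sum_coneMass_le (hΩ : Bornology.IsBounded Ω) (hK : K ∈ D.cells) :
    ∑ σ ∈ D.edgesOf K, D.coneMass K σ ≤ d * volume.real K := by
  rw [← ENNReal.ofReal_le_ofReal_iff (by positivity),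
    ENNReal.ofReal_sum_of_nonneg fun _ _ => coneMass_nonneg, ENNReal.ofReal_mul d.cast_nonneg,
    ENNReal.ofReal_natCast, ofReal_measureReal (volume_cell_ne_top hΩ hK)]
  refine le_of_eq_of_le (Finset.sum_congr rfl fun σ hσ => ?_) (sum_measure_mul_cellDist_le hK)
  rw [coneMass, ENNReal.ofReal_mul measureReal_nonneg,
    ofReal_measureReal (measure_edge_ne_top hΩ (D.edgesOf_subset K hK hσ))]

theorem jump_div_edgeDist_nonneg : 0 ≤ D.jump v K σ / D.edgeDist σ :=
  div_nonneg jump_nonneg edgeDist_nonneg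

theorem discreteNorm_nonneg : 0 ≤ D.discreteNorm p v :=
  Real.rpow_nonneg (Finset.sum_nonneg fun _ _ => Finset.sum_nonneg fun _ _ =>
    mul_nonneg coneMass_nonneg (Real.rpow_nonneg jump_div_edgeDist_nonneg _)) _

theorem IsRegular.measure_mul_jump_le (hη : 0 < η) (hD : D.IsRegular η) (hKσ : K ∈ D.cellsOf σ) :
    μHE[d - 1].real σ * D.jump v K σ ≤
      (1 + 1 / η) * (D.coneMass K σ * (D.jump v K σ / D.edgeDist σ)) := by
  calc μHE[d - 1].real σ * D.jump v K σ
      = μHE[d - 1].real σ * (D.jump v K σ / D.edgeDist σ) * D.edgeDist σ := by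
        rw [mul_assoc, div_mul_cancel₀ _ (edgeDist_pos hKσ).ne']
    _ ≤ μHE[d - 1].real σ * (D.jump v K σ / D.edgeDist σ) * ((1 + 1 / η) * D.cellDist K σ) :=
        mul_le_mul_of_nonneg_left (hD.edgeDist_le hη hKσ)
          (mul_nonneg measureReal_nonneg jump_div_edgeDist_nonneg)
    _ = (1 + 1 / η) * (D.coneMass K σ * (D.jump v K σ / D.edgeDist σ)) := by
        rw [coneMass]
        ring

theorem sum_coneMass_mul_abs_rpow_le (hΩ : Bornology.IsBounded Ω) :
    ∑ K ∈ D.cells, ∑ σ ∈ D.edgesOf K, D.coneMass K σ * |v K| ^ q ≤ d * D.powerSum q v := by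
  rw [powerSum, Finset.mul_sum]
  refine Finset.sum_le_sum fun K hK => ?_
  rw [← Finset.sum_mul, ← mul_assoc]
  gcongr
  exact sum_coneMass_le hΩ hK

theorem sum_abs_rpow_mul_coneMass_le (hp : 1 ≤ p) (hΩ : Bornology.IsBounded Ω) :
    ∑ K ∈ D.cells, ∑ σ ∈ D.edgesOf K,
        |v K| ^ (q * (1 - 1 / p)) * (D.coneMass K σ * (D.jump v K σ / D.edgeDist σ)) ≤
      (d * D.powerSum q v) ^ (1 - 1 / p) * D.discreteNorm p v := by
  have hp0 : 0 < p := by linarith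
  have hp1 : 0 ≤ 1 - 1 / p := sub_nonneg.2 ((div_le_one hp0).2 hp)
  have hsplit : ∀ K σ, |v K| ^ (q * (1 - 1 / p)) *
        (D.coneMass K σ * (D.jump v K σ / D.edgeDist σ)) =
      (D.coneMass K σ * |v K| ^ q) ^ (1 - 1 / p) *
        (D.coneMass K σ * (D.jump v K σ / D.edgeDist σ) ^ p) ^ (1 / p) := by
    intro K σ
    have hmass : D.coneMass K σ ^ (1 - 1 / p) * D.coneMass K σ ^ (1 / p) = D.coneMass K σ := by
      rw [← Real.rpow_add_of_nonneg coneMass_nonneg hp1 (by positivity), sub_add_cancel,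
        Real.rpow_one]
    rw [Real.mul_rpow coneMass_nonneg (by positivity), ← Real.rpow_mul (abs_nonneg _),
      Real.mul_rpow coneMass_nonneg (Real.rpow_nonneg jump_div_edgeDist_nonneg _), one_div,
      Real.rpow_rpow_inv jump_div_edgeDist_nonneg hp0.ne', ← one_div, mul_mul_mul_comm, hmass,
      mul_left_comm]
  simp_rw [hsplit, Finset.sum_sigma']
  refine (sum_rpow_mul_rpow_le _ (fun _ => mul_nonneg coneMass_nonneg (by positivity))
    (fun _ => mul_nonneg coneMass_nonneg (Real.rpow_nonneg jump_div_edgeDist_nonneg _)) hp1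
    (by positivity) (sub_add_cancel 1 (1 / p))).trans ?_
  rw [Finset.sum_sigma, Finset.sum_sigma]
  refine mul_le_mul_of_nonneg_right ?_ discreteNorm_nonneg
  refine Real.rpow_le_rpow ?_ (sum_coneMass_mul_abs_rpow_le hΩ) hp1
  exact Finset.sum_nonneg fun _ _ => Finset.sum_nonneg fun _ _ =>
    mul_nonneg coneMass_nonneg (by positivity)

theorem IsRegular.variation_abs_rpow_le_discreteNorm (hp : 1 ≤ p) (hη : 0 < η)
    (hD : D.IsRegular η) (hΩ : Bornology.IsBounded Ω) (hγ : 1 ≤ γ)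
    (hγq : γ - 1 = q * (1 - 1 / p)) :
    D.variation (fun K => |v K| ^ γ) ≤
      2 * γ * ((1 + 1 / η) * ((d * D.powerSum q v) ^ (1 - 1 / p) * D.discreteNorm p v)) := by
  refine (variation_abs_rpow_le hγ).trans (mul_le_mul_of_nonneg_left ?_ (by positivity))
  calc ∑ K ∈ D.cells, ∑ σ ∈ D.edgesOf K, μHE[d - 1].real σ * (|v K| ^ (γ - 1) * D.jump v K σ)
      ≤ ∑ K ∈ D.cells, ∑ σ ∈ D.edgesOf K, |v K| ^ (q * (1 - 1 / p)) *
          ((1 + 1 / η) * (D.coneMass K σ * (D.jump v K σ / D.edgeDist σ))) := by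
        refine Finset.sum_le_sum fun K hK => Finset.sum_le_sum fun σ hσ => ?_
        rw [mul_left_comm, hγq]
        exact mul_le_mul_of_nonneg_left (hD.measure_mul_jump_le hη (mem_cellsOf.2 ⟨hK, hσ⟩))
          (by positivity)
    _ = (1 + 1 / η) * ∑ K ∈ D.cells, ∑ σ ∈ D.edgesOf K, |v K| ^ (q * (1 - 1 / p)) *
          (D.coneMass K σ * (D.jump v K σ / D.edgeDist σ)) := by
        simp_rw [Finset.mul_sum, mul_left_comm]
    _ ≤ (1 + 1 / η) * ((d * D.powerSum q v) ^ (1 - 1 / p) * D.discreteNorm p v) :=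
        mul_le_mul_of_nonneg_left (sum_abs_rpow_mul_coneMass_le hp hΩ) (by positivity)

theorem IsRegular.powerSum_rpow_le_discreteNorm (hp : 1 ≤ p) (hpd : p < d) (hη : 0 < η)
    (hD : D.IsRegular η) (hΩ : Bornology.IsBounded Ω) (hq : q = p * d / (d - p)) :
    D.powerSum q v ^ (1 / q) ≤
      d * (2 * (p * (d - 1) / (d - p))) * (1 + 1 / η) * d ^ (1 - 1 / p) * D.discreteNorm p v := by
  have hd : 1 < (d : ℝ) := hp.trans_lt hpd
  have hd1 : 0 < (d : ℝ) - 1 := sub_pos.2 hd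
  have hdp : 0 < (d : ℝ) - p := sub_pos.2 hpd
  have : 0 < p := one_pos.trans_le hp
  set γ : ℝ := p * (d - 1) / (d - p) with hγ_def
  have hγ : 1 ≤ γ := by
    rw [hγ_def, one_le_div hdp]
    nlinarith
  have hγd : γ * (d / (d - 1)) = q := by
    rw [hq, hγ_def]
    field_simp
  have hγq : γ - 1 = q * (1 - 1 / p) := by
    rw [hq, hγ_def]
    field_simp
    ring
  have hexp : (d - 1) / d - (1 - 1 / p) = 1 / q := by
    rw [hq]
    field_simp
    ring
  have hN := discreteNorm_nonneg (D := D) (v := v) (p := p)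
  rcases (powerSum_nonneg (D := D) (w := v) (q := q)).eq_or_lt with h0 | hpos
  · rw [← h0, Real.zero_rpow (by rw [hq]; positivity)]
    positivity
  have hsobolev := powerSum_rpow_le_variation (Nat.one_lt_cast.1 hd) D hΩ fun K => |v K| ^ γ
  rw [powerSum_abs_rpow, hγd] at hsobolev
  have hvar := hD.variation_abs_rpow_le_discreteNorm (v := v) hp hη hΩ hγ hγq
  rw [Real.mul_rpow (by positivity) hpos.le] at hvar
  rw [← hexp, Real.rpow_sub hpos, div_le_iff₀ (Real.rpow_pos_of_pos hpos _)]
  refine (hsobolev.trans (mul_le_mul_of_nonneg_left hvar (by positivity))).trans_eq ?_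
  ring

theorem eLpNorm_cellFunction (hq : 0 < q) (hΩ : Bornology.IsBounded Ω) :
    eLpNorm (D.cellFunction v) (ENNReal.ofReal q) volume =
      ENNReal.ofReal (D.powerSum q v ^ (1 / q)) := by
  rw [eLpNorm_eq_lintegral_rpow_enorm_toReal (by simpa using hq) ENNReal.ofReal_ne_top,
    ENNReal.toReal_ofReal hq.le, lintegral_cellFunction_rpow hq hΩ,
    ENNReal.ofReal_rpow_of_nonneg powerSum_nonneg (by positivity)]

end Discretisation

theorem lemma5p2_general {d : ℕ} {p : ℝ} (hp : 1 ≤ p) (hpd : p < d) {η : ℝ} (hη : 0 < η) :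
    ∃ C : ℝ, 0 < C ∧
      ∀ Ω : Set (EuclideanSpace ℝ (Fin d)), Bornology.IsBounded Ω →
      ∀ D : Discretisation Ω, D.IsRegular η →
      ∀ (u : EuclideanSpace ℝ (Fin d) → ℝ) (v : Set (EuclideanSpace ℝ (Fin d)) → ℝ),
        D.HasCellValues u v →
        eLpNorm u (ENNReal.ofReal (p * d / (d - p))) (volume.restrict Ω) ≤
          ENNReal.ofReal (C * D.discreteNorm p v) := by
  have hd1 : 0 < (d : ℝ) - 1 := sub_pos.2 (hp.trans_lt hpd)
  have : 0 < (d : ℝ) - p := sub_pos.2 hpd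
  have hd : 0 < (d : ℝ) := by linarith
  have : 0 < p := one_pos.trans_le hp
  refine ⟨d * (2 * (p * (d - 1) / (d - p))) * (1 + 1 / η) * d ^ (1 - 1 / p), by positivity,
    fun Ω hΩ D hD u v hu => ?_⟩
  have hu' : u =ᵐ[volume.restrict Ω] D.cellFunction v :=
    ae_mono (Measure.restrict_mono_set _ subset_closure) (Discretisation.ae_eq_cellFunction hu)
  calc eLpNorm u (ENNReal.ofReal (p * d / (d - p))) (volume.restrict Ω)
      = eLpNorm (D.cellFunction v) (ENNReal.ofReal (p * d / (d - p))) (volume.restrict Ω) :=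
        eLpNorm_congr_ae hu'
    _ ≤ eLpNorm (D.cellFunction v) (ENNReal.ofReal (p * d / (d - p))) volume :=
        eLpNorm_mono_measure _ Measure.restrict_le_self
    _ = ENNReal.ofReal (D.powerSum (p * d / (d - p)) v ^ (1 / (p * d / (d - p)))) :=
        Discretisation.eLpNorm_cellFunction (by positivity) hΩ
    _ ≤ _ := ENNReal.ofReal_le_ofReal (hD.powerSum_rpow_le_discreteNorm hp hpd hη hΩ rfl)

theorem lemma5p2 (d : ℕ) (hd : 1 < d) (p : ℝ) (hp : 1 < p) (hpd : p < (d : ℝ))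
    (η : ℝ) (hη : 0 < η) :
    ∃ C : ℝ, 0 < C ∧
      ∀ Ω : Set (EuclideanSpace ℝ (Fin d)),
        IsOpen Ω → Bornology.IsBounded Ω → IsConnected Ω → HasPolyhedralBoundary Ω →
      ∀ D : Discretisation Ω, D.IsRegular η →
      ∀ (u : EuclideanSpace ℝ (Fin d) → ℝ) (v : Set (EuclideanSpace ℝ (Fin d)) → ℝ),
        D.HasCellValues u v →
        eLpNorm u (ENNReal.ofReal (p * d / (d - p))) (volume.restrict Ω) ≤
          ENNReal.ofReal (C * D.discreteNorm p v) := by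
  obtain ⟨C, hC, h⟩ := lemma5p2_general hp.le hpd hη
  exact ⟨C, hC, fun Ω _ hΩ _ _ => h Ω hΩ⟩
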